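/- Let $n\ge 1$. A $3$-permutation of size $n$ is a pair $(\sigma,\tau)$ of permutations of $\{1,\dots,n\}$. It contains a pattern $(\pi,\rho)\in S_k^2$ if there are indices $i_1<\dots<i_k$ such that $\sigma(i_1)\cdots\sigma(i_k)$ is ordered like $\pi$ and $\tau(i_1)\cdots\tau(i_k)$ is ordered like $\rho$ (same indices for both); $Av_n(\dots)$ denotes the set of $3$-permutations of size $n$ containing none of the listed patterns. For a permutation $\sigma$ put $R_\sigma(i)=\{j>i:\sigma(j)<\sigma(i)\}$ and $L_\sigma(i)=\{j<i:\sigma(j)>\sigma(i)\}$, and let $\Gamma(\sigma,\tau)=\{(|R_\sigma(i)|,|L_\tau(i)|):1\le i\le n\}\subset\mathbb Z^2$. There is a solitaire move on the grid from a finite set $P\subset\mathbb{Z}^2$ to a finite set $Q\subset\mathbb{Z}^2$ if for some $(x,y)\in\mathbb Z^2$ and $T=\{(x,y),(x+1,y),(x,y+1)\}$ the symmetric difference $P\,\Delta\,Q$ is a subset of $T$ of size $2$ and $|P\cap T|=|Q\cap T|=2$. There is a solitaire move from $(\sigma,\tau)\in Av_n((12,12))$ to a $3$-permutation $(\sigma',\tau')$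 if there is a solitaire move on the grid from $\Gamma(\sigma,\tau)$ to $\Gamma(\sigma',\tau')$, and there are $i<j$ with $R_\sigma(i)\in\{R_\sigma(j),R_\sigma(j)\cup\{j\}\}$ and $L_\tau(j)\in\{L_\tau(i),L_\tau(i)\cup\{i\}\}$ such that $(\sigma',\tau')$ arises from $(\sigma,\tau)$ by exchanging the values $\sigma(i)$ and $\sigma(j)$, or the values $\tau(i)$ and $\tau(j)$, or both. The orbit $\mathcal O((\sigma,\tau))$ is the set of all $3$-permutations reachable from $(\sigma,\tau)$ by finitely many (possibly zero) solitaire moves. Theorem. For all $n\ge 1$, with $\mathrm{id}$ the identity and $\overline{\mathrm{id}}=n(n-1)\cdots 21$ the reverse identity, $$\mathcal O((\overline{\mathrm{id}},\mathrm{id}))=Av_n\big((12,12),(312,231)\big).$$ -/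

import Mathlib

namespace ThreePerm

/-- A 3-permutation of size `n` (the diagram is `{(i, σ i, τ i)}`), written as the pair `(σ, τ)`.
Positions and values are indexed by `Fin n = {0, …, n - 1}` instead of `{1, …, n}`. -/
abbrev Perm3 (n : ℕ) : Type := Equiv.Perm (Fin n) × Equiv.Perm (Fin n)

/-- `p` contains the pattern `q`: on some increasing sequence of indices, the same for both
components, each component of `p` is ordered like the corresponding component of `q`. -/
def Contains {k n : ℕ} (p : Perm3 n) (q : Perm3 k) : Prop :=
  ∃ f : Fin k → Fin n, StrictMono f ∧
    ∀ a b : Fin k, (p.1 (f a) < p.1 (f b) ↔ q.1 a < q.1 b) ∧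
      (p.2 (f a) < p.2 (f b) ↔ q.2 a < q.2 b)

/-- The set of 3-permutations of size `n` avoiding all the given patterns. -/
def Av (n : ℕ) (patterns : Set (Σ k : ℕ, Perm3 k)) : Set (Perm3 n) :=
  {p | ∀ q ∈ patterns, ¬ Contains p q.2}

/-- The permutation `12`. -/
def perm12 : Equiv.Perm (Fin 2) := Equiv.refl (Fin 2)

/-- The permutation `312`. -/
def perm312 : Equiv.Perm (Fin 3) where
  toFun := ![2, 0, 1]
  invFun := ![1, 2, 0]
  left_inv := by decide
  right_inv := by decide

/-- The permutation `231`. -/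
def perm231 : Equiv.Perm (Fin 3) where
  toFun := ![1, 2, 0]
  invFun := ![2, 0, 1]
  left_inv := by decide
  right_inv := by decide

/-- The pattern `(12, 12)`. -/
def pat12 : Σ k : ℕ, Perm3 k := ⟨2, (perm12, perm12)⟩

/-- The pattern `(312, 231)`. -/
def pat312 : Σ k : ℕ, Perm3 k := ⟨3, (perm312, perm231)⟩

/-- `R_σ(i)`: the right inversions of `σ` at `i`. -/
def rightInv {n : ℕ} (σ : Equiv.Perm (Fin n)) (i : Fin n) : Finset (Fin n) :=
  {j | i < j ∧ σ j < σ i}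

/-- `L_σ(i)`: the left inversions of `σ` at `i`. -/
def leftInv {n : ℕ} (σ : Equiv.Perm (Fin n)) (i : Fin n) : Finset (Fin n) :=
  {j | j < i ∧ σ i < σ j}

/-- The map `Γ`: the set of the points `(|R_σ(i)|, |L_τ(i)|)` of the grid. -/
def Gam {n : ℕ} (p : Perm3 n) : Finset (ℤ × ℤ) :=
  Finset.univ.image fun i : Fin n => (((rightInv p.1 i).card : ℤ), ((leftInv p.2 i).card : ℤ))

/-- The three cells of the grid involved in a solitaire move at `(x, y)`. -/
def cells (x y : ℤ) : Finset (ℤ × ℤ) := {(x, y), (x + 1, y), (x, y + 1)}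

/-- A solitaire move on the grid: some three cells `{(x,y), (x+1,y), (x,y+1)}` hold exactly two
marbles; one of the two moves to the free cell, the other one being the pivot. -/
def GridMove (P Q : Finset (ℤ × ℤ)) : Prop :=
  ∃ x y : ℤ, symmDiff P Q ⊆ cells x y ∧ (symmDiff P Q).card = 2 ∧
    (P ∩ cells x y).card = 2 ∧ (Q ∩ cells x y).card = 2

/-- The condition on `p = (σ, τ)` under which a solitaire move at the indices `(i, j)` can be
performed. -/
def CanMove {n : ℕ} (p : Perm3 n) (i j : Fin n) : Prop :=
  i < j ∧
    (rightInv p.1 i = rightInv p.1 j ∨ rightInv p.1 i = insert j (rightInv p.1 j)) ∧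
    (leftInv p.2 j = leftInv p.2 i ∨ leftInv p.2 j = insert i (leftInv p.2 i))

/-- `q` arises from `p = (σ, τ)` by exchanging the coordinates of the diagram points `i` and `j`
along one of the three axes: exchange the values of `σ`, or those of `τ`, or both (the latter is
the exchange of the abscissas `i` and `j`). -/
def IsExchange {n : ℕ} (p q : Perm3 n) (i j : Fin n) : Prop :=
  q = (p.1 * Equiv.swap i j, p.2) ∨
    q = (p.1, p.2 * Equiv.swap i j) ∨
    q = (p.1 * Equiv.swap i j, p.2 * Equiv.swap i j)

/-- A solitaire move from `p` to `q`, on 3-permutations avoiding `(12, 12)`: an exchange at some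
admissible pair of indices which `Γ` maps to a solitaire move on the grid. (Of the three
exchanges at an admissible pair, two have this property; the third would put two labels on the
same cell.) -/
def SolitaireMove {n : ℕ} (p q : Perm3 n) : Prop :=
  p ∈ Av n {pat12} ∧
    (∃ i j : Fin n, CanMove p i j ∧ IsExchange p q i j) ∧
    GridMove (Gam p) (Gam q)

/-- The orbit of `p`: all 3-permutations reachable from it by finitely many solitaire moves. -/
def orbit {n : ℕ} (p : Perm3 n) : Set (Perm3 n) :=
  {q | Relation.ReflTransGen SolitaireMove p q}

/-- The pair formed by the reverse identity `n (n-1) … 2 1` and the identity. -/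
def start (n : ℕ) : Perm3 n := (Fin.revPerm, Equiv.refl (Fin n))

end ThreePerm

/-!
A 3-permutation is treated as three linear orders `a`, `b`, `c` (position, first value, second value)
on a set of labels, up to relabelling. The cyclic rotation `(a, b, c) → (b, c, a)` is then a symmetry
of everything involved: of avoiding `(12, 12)` (no two labels are ordered alike by all three), of the
pattern `(312, 231)` (three labels whose orders are the three cyclic rotations of one another), and of
the moves. If `(12, 12)` is avoided, every label `k ≠ i` lies in exactly one of three classes with
respect to `i`: after `i` in `a` and before it in `b`, or the same for `(b, c)`, or for `(c, a)`. The
sizes of the three classes are the barycentric coordinates of the grid point of `i`, two of them being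
the coordinates that `Γ` records. A pair satisfies the admissibility condition of a move exactly when
its members are twins: every third label is in the same class with respect to both. The move swaps
the two labels in one of the orders, and the other two orders have to disagree on the pair; otherwise
both labels would land on the same grid point (`Tri.Twin.pt_eq`).

One inclusion is the invariance of pattern avoidance under such swaps (`Tri.Good.swapC`).

For the other one, every set of at least two labels of an avoiding triple has, up to rotation, a
proper corner: a subset which is a final segment for `a` and an initial segment for `b`
(`Tri.Good.not_uncut`). The proof removes the `a`-first label, takes a corner of the remainder by
induction, and compares the three orders; the decisive facts are that a minimal corner is connected
in the graph of pairs on which `a` and `b` agree (`MinCorner.no_split`) and therefore, as `(312, 231)`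
is avoided, is not separated in the order `c` by any label outside it (`Tri.Good.unsplit`).

Because of the latter, a minimal corner is a module: labels outside it do not distinguish its
members, so it can be rearranged by moves on its own. By induction it becomes a line, meaning that
`a` and `c` agree and `b` is opposite. Its `a`-last label `e` is then `a`-last and `b`-first among
all labels, so the labels other than `e` also form a module. They are rearranged into a line of
another direction, along which `e` slides to the `c`-last place (`Tri.slide`); after straightening
the other labels once more, everything is a line. Applied to all labels, this carries any avoiding
3-permutation to `start n`, and moves are reversible.
-/

namespace ThreePerm

open Equiv

variable {n : ℕ}

/-! ### Triples of orders -/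

/-- Three linear orders on the labels `Fin n`, each given by the rank of every label. The 3-permutation
`(σ, τ)` is the case `(1, σ, τ)`, where a label is its own position. -/
structure Tri (n : ℕ) where
  a : Perm (Fin n)
  b : Perm (Fin n)
  c : Perm (Fin n)

namespace Tri

/-- The cyclic rotation of the three orders. -/
def rot (t : Tri n) : Tri n := ⟨t.b, t.c, t.a⟩

/-- Avoidance of `(12, 12)` and `(312, 231)`, expressed by the three orders. -/
structure Good (t : Tri n) : Prop where
  not_all : ∀ i j, t.a i < t.a j → t.b i < t.b j → t.c j < t.c i
  not_cyc : ∀ p q r, t.a p < t.a q → t.a q < t.a r → t.b q < t.b r → t.b r < t.b p →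
    t.c r < t.c p → ¬ t.c p < t.c q

lemma Good.rot {t : Tri n} (h : t.Good) : t.rot.Good where
  not_all i j hb hc := by
    have h1 := h.not_all i j
    have h2 : t.a i ≠ t.a j := fun e => by
      rw [t.a.injective e] at hb; exact lt_irrefl _ hb
    simp only [Tri.rot] at *
    omega
  not_cyc p q r h1 h2 h3 h4 h5 h6 := h.not_cyc r p q h5 h6 h1 h2 h3 h4

end Tri

/-- `T` is a nonempty subset of `W`, a final segment of `W` for `a` and an initial one for `b`.
The case `T = W` is allowed. -/
def Corner (a b : Perm (Fin n)) (W T : Finset (Fin n)) : Prop :=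
  T ⊆ W ∧ T.Nonempty ∧ ∀ s ∈ W, s ∉ T → ∀ t ∈ T, a s < a t ∧ b t < b s

lemma Corner.refl (a b : Perm (Fin n)) {W : Finset (Fin n)} (hW : W.Nonempty) :
    Corner a b W W :=
  ⟨Finset.Subset.refl _, hW, fun _ h h' => absurd h h'⟩

/-- A corner that contains no smaller corner. -/
def MinCorner (a b : Perm (Fin n)) (W K : Finset (Fin n)) : Prop :=
  Corner a b W K ∧ ∀ K' ⊆ K, Corner a b W K' → K' = K

lemma Corner.exists_min {a b : Perm (Fin n)} {W T : Finset (Fin n)} (h : Corner a b W T) :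
    ∃ K ⊆ T, MinCorner a b W K := by
  classical
  obtain ⟨K, hK, hmin⟩ := Finset.exists_min_image
    (Finset.univ.filter fun K : Finset (Fin n) => K ⊆ T ∧ Corner a b W K) Finset.card
    ⟨T, by simp [h]⟩
  simp only [Finset.mem_filter, Finset.mem_univ, true_and] at hK hmin
  refine ⟨K, hK.1, hK.2, fun K' hK' hc => Finset.eq_of_subset_of_card_le hK' ?_⟩
  exact hmin K' ⟨hK'.trans hK.1, hc⟩

lemma Corner.exists_max {a b : Perm (Fin n)} {W T : Finset (Fin n)} (h : Corner a b W T)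
    (hT : T ≠ W) :
    ∃ N, N ≠ W ∧ Corner a b W N ∧ ∀ N', N' ≠ W → Corner a b W N' → N ⊆ N' → N' = N := by
  classical
  obtain ⟨N, hN, hmax⟩ := Finset.exists_max_image
    (Finset.univ.filter fun N : Finset (Fin n) => N ≠ W ∧ Corner a b W N) Finset.card
    ⟨T, by simp [h, hT]⟩
  simp only [Finset.mem_filter, Finset.mem_univ, true_and] at hN hmax
  refine ⟨N, hN.1, hN.2, fun N' h1 h2 h3 => ?_⟩
  exact (Finset.eq_of_subset_of_card_le h3 (hmax N' ⟨h1, h2⟩)).symm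

/-- A minimal corner `K` is connected in the graph of pairs ordered alike by `a` and `b`: a property
constant along the edges of this graph is constant on `K`. Otherwise let `l` be the `a`-last label on
the side that does not contain the `a`-last label of `K`; the part of `K` after `l` is a smaller
corner. -/
lemma MinCorner.no_split {a b : Perm (Fin n)} {W K : Finset (Fin n)} (hK : MinCorner a b W K)
    (p : Fin n → Prop)
    (hp : ∀ x ∈ K, ∀ y ∈ K, p x → ¬ p y → (a x < a y → b y < b x) ∧ (a y < a x → b x < b y))
    {x y : Fin n} (hx : x ∈ K) (hy : y ∈ K) (hpx : p x) : p y := by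
  classical
  by_contra hpy
  obtain ⟨⟨hsub, hne, hc⟩, hmin⟩ := hK
  obtain ⟨e, heK, he⟩ := Finset.exists_max_image K a hne
  obtain ⟨l, hl, hlmax⟩ := Finset.exists_max_image (K.filter fun k => ¬ (p k ↔ p e)) a (by
    by_cases h : p e
    · exact ⟨y, by simp [hy, hpy, h]⟩
    · exact ⟨x, by simp [hx, hpx, h]⟩)
  simp only [Finset.mem_filter, and_imp] at hl hlmax
  have hle : a l < a e := lt_of_le_of_ne (he l hl.1) fun h => by
    have := a.injective h; subst this; exact hl.2 Iff.rfl
  have hdis : ∀ u ∈ K, ∀ w ∈ K, ¬ (p u ↔ p w) → a u < a w → b w < b u := by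
    intro u hu w hw huw h
    by_cases h1 : p u
    · exact (hp u hu w hw h1 (by tauto)).1 h
    · exact (hp w hw u hu (by tauto) h1).2 h
  have hF : Corner a b W (K.filter fun t => a l < a t) := by
    refine ⟨(Finset.filter_subset _ _).trans hsub, ⟨e, by simp [heK, hle]⟩, ?_⟩
    intro s hs hsF t ht
    simp only [Finset.mem_filter, not_and] at hsF ht
    by_cases hsK : s ∈ K
    · have h1 : a s ≤ a l := not_lt.1 (hsF hsK)
      have h2 : a s < a t := lt_of_le_of_lt h1 ht.2
      have hpt : p t ↔ p e := by
        by_contra h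
        exact absurd ht.2 (not_lt.2 (hlmax t ht.1 h))
      refine ⟨h2, ?_⟩
      by_cases hps : p s ↔ p e
      · have h3 : a s < a l := lt_of_le_of_ne h1 fun h => by
          have := a.injective h; subst this; exact hl.2 hps
        exact (hdis l hl.1 t ht.1 (by tauto) ht.2).trans (hdis s hsK l hl.1 (by tauto) h3)
      · exact hdis s hsK t ht.1 (by tauto) h2
    · exact hc s hs hsK t ht.1
  have := hmin _ (Finset.filter_subset _ _) hF
  rw [← this] at hl
  simp at hl

/-- A label outside a minimal corner does not separate two labels of the corner in the third order:
on an edge of the graph of `MinCorner.no_split` with ends on the two sides it would give the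
pattern `(312, 231)`. -/
lemma Tri.Good.unsplit {t : Tri n} (h : t.Good) {W K : Finset (Fin n)}
    (hK : MinCorner t.a t.b W K) {s : Fin n} (hs : s ∈ W) (hsK : s ∉ K) {x y : Fin n}
    (hx : x ∈ K) (hy : y ∈ K) : t.c s < t.c x → t.c s < t.c y := by
  refine hK.no_split (fun x => t.c s < t.c x) ?_ hx hy
  intro x hx y hy hcx hcy
  have h1 := hK.1.2.2 s hs hsK x hx
  have h2 := hK.1.2.2 s hs hsK y hy
  have hsy : t.c s ≠ t.c y := fun e => by
    have := t.c.injective e; subst this; exact hsK hy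
  have hxy : x ≠ y := fun e => hcy (e ▸ hcx)
  have hb := t.b.injective.ne hxy
  have h3 := h.not_cyc s x y
  have h4 := h.not_all y x
  omega

lemma Tri.Good.unsplit' {t : Tri n} (h : t.Good) {W K : Finset (Fin n)}
    (hK : MinCorner t.a t.b W K) {s : Fin n} (hs : s ∈ W) (hsK : s ∉ K) {x y : Fin n}
    (hx : x ∈ K) (hy : y ∈ K) (hc : t.c x < t.c s) : t.c y < t.c s := by
  have h1 := h.unsplit hK hs hsK hy hx
  have h2 : t.c s ≠ t.c y := fun e => by
    have := t.c.injective e; subst this; exact hsK hy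
  omega

/-! ### A corner exists -/

/-- `W` has no proper corner, for any of the three rotations. -/
structure Uncut (t : Tri n) (W : Finset (Fin n)) : Prop where
  ab : ∀ T, Corner t.a t.b W T → T = W
  bc : ∀ T, Corner t.b t.c W T → T = W
  ca : ∀ T, Corner t.c t.a W T → T = W

/-- `v` is the `a`-first label of `W`. -/
structure FirstIn (t : Tri n) (W : Finset (Fin n)) (v : Fin n) : Prop where
  mem : v ∈ W
  lt : ∀ x ∈ W, x ≠ v → t.a v < t.a x

section
variable {t : Tri n} {W : Finset (Fin n)} {v : Fin n}

/-- Without such a label, `W` minus `v` would be a corner for `(a, b)`. -/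
lemma exists_b_lt (hu : Uncut t W) (hv : FirstIn t W v)
    (hne : (W.erase v).Nonempty) : ∃ e ∈ W, t.b v < t.b e := by
  by_contra hcon
  push Not at hcon
  have := hu.ab (W.erase v) ⟨Finset.erase_subset _ _, hne, by
    intro s hs hsT x hx
    rw [Finset.mem_erase] at hsT hx
    have hsv : s = v := by by_contra h; exact hsT ⟨h, hs⟩
    subst hsv
    have h1 := hcon x hx.2
    have h2 := t.b.injective.ne hx.1
    exact ⟨hv.lt x hx.2 hx.1, by omega⟩⟩
  have h := hv.mem
  rw [← this] at h
  simp at h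

/-- Without such a label, `{v}` would be a corner for `(c, a)`. -/
lemma exists_c_lt (hu : Uncut t W) (hv : FirstIn t W v)
    (hne : (W.erase v).Nonempty) : ∃ q ∈ W, t.c v < t.c q := by
  by_contra hcon
  push Not at hcon
  have := hu.ca {v} ⟨by simpa using hv.mem, by simp, by
    intro s hs hsT x hx
    rw [Finset.mem_singleton] at hsT hx
    subst hx
    have h1 := hcon s hs
    have h2 := t.c.injective.ne hsT
    exact ⟨by omega, hv.lt s hs hsT⟩⟩
  rw [← this] at hne
  simp at hne

lemma not_both (h : t.Good) (hv : FirstIn t W v) {x : Fin n} (hx : x ∈ W) :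
    t.b v < t.b x → t.c x < t.c v := by
  intro hb
  have hxv : x ≠ v := by rintro rfl; exact lt_irrefl _ hb
  exact h.not_all v x (hv.lt x hx hxv) hb

/-- A label before `v` in both `b` and `c` and a label after `v` in `c` are ordered oppositely by
`a` and `b`: otherwise they form the pattern `(312, 231)` with `v`, or the pattern `(12, 12)`. -/
lemma no_b_edge (h : t.Good) (hv : FirstIn t W v) {r q : Fin n} (hq : q ∈ W)
    (h1 : t.b r < t.b v) (h2 : t.c r < t.c v) (h3 : t.c v < t.c q) :
    (t.a r < t.a q → t.b q < t.b r) ∧ (t.a q < t.a r → t.b r < t.b q) := by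
  have hqv : q ≠ v := by rintro rfl; exact lt_irrefl _ h3
  have hrq : r ≠ q := by rintro rfl; omega
  have h4 := t.b.injective.ne hrq
  have h5 := h.not_cyc v q r (hv.lt q hq hqv)
  have h6 := h.not_all r q
  constructor <;> omega

/-- If `W` minus its `a`-first label `v` has a proper corner for `(a, b)`, take a minimal one, `K`. As
`v` separates some of `K` from the rest in `c`, the labels outside `K` form a corner for `(b, c)`. -/
lemma corner_ab_false (h : t.Good) (hu : Uncut t W) (hv : FirstIn t W v) {T : Finset (Fin n)}
    (hT : Corner t.a t.b (W.erase v) T) (hTW : T ≠ W.erase v) : False := by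
  classical
  obtain ⟨K, hKT, hK⟩ := hT.exists_min
  have hKsub := hK.1.1
  obtain ⟨s0, hs0, hs0K⟩ : ∃ s ∈ W.erase v, s ∉ K := by
    by_contra hcon
    push Not at hcon
    exact hTW (Finset.Subset.antisymm hT.1 fun x hx => hKT (hcon x hx))
  have hKne := hK.1.2.1
  have hnv : ∀ x ∈ K, x ∈ W ∧ x ≠ v := fun x hx => by
    have := hKsub hx; rw [Finset.mem_erase] at this; tauto
  -- If all of `K` were before `v` in `b`, then `K` would be a corner of `W`.
  obtain ⟨x0, hx0, hbx0⟩ : ∃ x ∈ K, t.b v < t.b x := by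
    by_contra hcon
    push Not at hcon
    have := hu.ab K ⟨fun x hx => (hnv x hx).1, hKne, by
      intro s hs hsK x hx
      by_cases hsv : s = v
      · subst hsv
        have h1 := t.b.injective.ne (hnv x hx).2
        have h2 := hcon x hx
        exact ⟨hv.lt x (hnv x hx).1 (hnv x hx).2, by omega⟩
      · exact hK.1.2.2 s (Finset.mem_erase.2 ⟨hsv, hs⟩) hsK x hx⟩
    rw [this] at hs0K
    exact hs0K (Finset.mem_of_mem_erase hs0)
  have hSb : ∀ s ∈ W, s ≠ v → s ∉ K → t.b v < t.b s := fun s hs hsv hsK =>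
    hbx0.trans (hK.1.2.2 s (Finset.mem_erase.2 ⟨hsv, hs⟩) hsK x0 hx0).2
  obtain ⟨q, hq, hcq⟩ := exists_c_lt hu hv ⟨s0, hs0⟩
  have hqv : q ≠ v := by rintro rfl; exact lt_irrefl _ hcq
  have hqK : q ∈ K := by
    by_contra hqK
    have := not_both h hv hq (hSb q hq hqv hqK)
    omega
  have := hu.bc ((W.erase v) \ K) ⟨Finset.sdiff_subset.trans (Finset.erase_subset _ _),
    ⟨s0, Finset.mem_sdiff.2 ⟨hs0, hs0K⟩⟩, by
    intro x hx hxS s hs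
    rw [Finset.mem_sdiff, Finset.mem_erase] at hs hxS
    have h1 := hSb s hs.1.2 hs.1.1 hs.2
    have h2 := not_both h hv hs.1.2 h1
    by_cases hxv : x = v
    · subst hxv
      exact ⟨h1, h2⟩
    · have hxK : x ∈ K := by by_contra hxK; exact hxS ⟨⟨hxv, hx⟩, hxK⟩
      refine ⟨(hK.1.2.2 s (Finset.mem_erase.2 hs.1) hs.2 x hxK).2, ?_⟩
      refine h.unsplit hK (Finset.mem_erase.2 hs.1) hs.2 hqK hxK (by omega)⟩
  have hv' := hv.mem
  rw [← this] at hv'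
  simp at hv'

/-- If `W` minus its `a`-first label `v` has a proper corner for `(b, c)`, take a minimal one, `N`; the
labels outside it lie wholly before or wholly after `N` in `a`. A minimal `(a, b)`-corner of
these labels that is contained in the part after `N` would be a corner of `W`; so it also meets the
part before `N`, and then it is disconnected by `no_b_edge`. -/
lemma corner_bc_false (h : t.Good) (hu : Uncut t W) (hv : FirstIn t W v) {T : Finset (Fin n)}
    (hT : Corner t.b t.c (W.erase v) T) (hTW : T ≠ W.erase v) : False := by
  classical
  obtain ⟨N, hNT, hN⟩ := hT.exists_min
  obtain ⟨s0, hs0, hs0N⟩ : ∃ s ∈ W.erase v, s ∉ N := by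
    by_contra hcon
    push Not at hcon
    exact hTW (Finset.Subset.antisymm hT.1 fun x hx => hNT (hcon x hx))
  have hnv : ∀ x ∈ N, x ∈ W ∧ x ≠ v := fun x hx => by
    have := hN.1.1 hx; rw [Finset.mem_erase] at this; tauto
  have hc := hN.1.2.2
  have hcut : ∀ s ∈ W, s ≠ v → s ∉ N → ∀ x ∈ N, t.b s < t.b x ∧ t.c x < t.c s :=
    fun s hs hsv hsN x hx => hc s (Finset.mem_erase.2 ⟨hsv, hs⟩) hsN x hx
  have hvN : v ∉ N := fun hh => (hnv v hh).2 rfl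
  have hne : (W.erase v).Nonempty := ⟨s0, hs0⟩
  rw [Finset.mem_erase] at hs0
  -- If all of `N` were after `v` in `b`, then `N` would be a corner of `W`.
  obtain ⟨n0, hn0, hn0b⟩ : ∃ x ∈ N, t.b x < t.b v := by
    by_contra hcon
    push Not at hcon
    have := hu.bc N ⟨fun x hx => (hnv x hx).1, hN.1.2.1, by
      intro s hs hsN x hx
      by_cases hsv : s = v
      · subst hsv
        have h1 := t.b.injective.ne (hnv x hx).2
        have h2 := hcon x hx
        have h3 := not_both h hv (hnv x hx).1
        omega
      · exact hcut s hs hsv hsN x hx⟩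
    rw [this] at hvN
    exact hvN hv.mem
  have hRb : ∀ s ∈ W, s ≠ v → s ∉ N → t.b s < t.b v := fun s hs hsv hsN =>
    (hcut s hs hsv hsN n0 hn0).1.trans hn0b
  -- If all labels outside `N` were after `v` in `c`, then `insert v N` would be a corner of `W`.
  obtain ⟨s1, hs1, hs1v, hs1N, hs1c⟩ : ∃ s ∈ W, s ≠ v ∧ s ∉ N ∧ t.c s < t.c v := by
    by_contra hcon
    push Not at hcon
    have := hu.bc (insert v N) ⟨by
      intro x hx
      rw [Finset.mem_insert] at hx
      rcases hx with rfl | hx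
      · exact hv.mem
      · exact (hnv x hx).1, by simp, by
      intro s hs hsN x hx
      rw [Finset.mem_insert] at hsN hx
      push Not at hsN
      rcases hx with rfl | hx
      · have h1 := hcon s hs hsN.1 hsN.2
        have h2 := t.c.injective.ne hsN.1
        exact ⟨hRb s hs hsN.1 hsN.2, by omega⟩
      · exact hcut s hs hsN.1 hsN.2 x hx⟩
    have h5 := hs0.2
    rw [← this, Finset.mem_insert] at h5
    exact h5.elim hs0.1 hs0N
  have hNc : ∀ x ∈ N, t.c x < t.c v := fun x hx => (hcut s1 hs1 hs1v hs1N x hx).2.trans hs1c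
  obtain ⟨q, hq, hcq⟩ := exists_c_lt hu hv hne
  have hqv : q ≠ v := by rintro rfl; exact lt_irrefl _ hcq
  have hqN : q ∉ N := fun hh => by have := hNc q hh; omega
  have hqa : ∀ q ∈ W, t.c v < t.c q → t.a n0 < t.a q := by
    intro q hq hcq
    have hqv : q ≠ v := by rintro rfl; exact lt_irrefl _ hcq
    have hqN : q ∉ N := fun hh => by have := hNc q hh; omega
    have h1 := no_b_edge h hv hq hn0b (hNc n0 hn0) hcq
    have h2 := hcut q hq hqv hqN n0 hn0
    have h3 : n0 ≠ q := by rintro rfl; exact hqN hn0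
    have := t.a.injective.ne h3
    omega
  have huns : ∀ s ∈ W, s ≠ v → s ∉ N → ∀ x ∈ N, t.a n0 < t.a s → t.a x < t.a s :=
    fun s hs hsv hsN x hx hlt =>
      h.rot.unsplit' hN (Finset.mem_erase.2 ⟨hsv, hs⟩) hsN hn0 hx hlt
  have huns' : ∀ s ∈ W, s ≠ v → s ∉ N → ∀ x ∈ N, t.a s < t.a n0 → t.a s < t.a x :=
    fun s hs hsv hsN x hx hlt =>
      h.rot.unsplit hN (Finset.mem_erase.2 ⟨hsv, hs⟩) hsN hn0 hx hlt
  -- A minimal corner of the labels outside `N`; it meets the part before `N` in `a`, and being a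
  -- final segment for `a` it contains the labels `q` after `v` in `c`.
  obtain ⟨K, -, hK⟩ := (Corner.refl t.a t.b (W := (W.erase v) \ N)
    ⟨q, by simp [hq, hqv, hqN]⟩).exists_min
  have hKR : ∀ x ∈ K, x ∈ W ∧ x ≠ v ∧ x ∉ N := fun x hx => by
    have := hK.1.1 hx; rw [Finset.mem_sdiff, Finset.mem_erase] at this; tauto
  have hKc : ∀ s ∈ W, s ≠ v → s ∉ N → s ∉ K → ∀ x ∈ K, t.a s < t.a x ∧ t.b x < t.b s :=
    fun s hs hsv hsN hsK => hK.1.2.2 s (by simp [hs, hsv, hsN]) hsK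
  obtain ⟨u, huK, hua⟩ : ∃ u ∈ K, t.a u < t.a n0 := by
    by_contra hcon
    push Not at hcon
    have := hu.ab K ⟨fun x hx => (hKR x hx).1, hK.1.2.1, by
      intro s hs hsK x hx
      obtain ⟨hxW, hxv, hxN⟩ := hKR x hx
      by_cases hsv : s = v
      · subst hsv
        exact ⟨hv.lt x hxW hxv, hRb x hxW hxv hxN⟩
      by_cases hsN : s ∈ N
      · have h1 := hcon x hx
        have h2 : x ≠ n0 := by rintro rfl; exact hxN hn0
        have h3 := t.a.injective.ne h2
        exact ⟨huns x hxW hxv hxN s hsN (by omega), (hcut x hxW hxv hxN s hsN).1⟩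
      · exact hKc s hs hsv hsN hsK x hx⟩
    have h1 := hv.mem
    rw [← this] at h1
    exact (hKR v h1).2.1 rfl
  obtain ⟨huW, huv, huN⟩ := hKR u huK
  have hqK : q ∈ K := by
    by_contra hqK
    have h1 := hKc q hq hqv hqN hqK u huK
    have h2 := hqa q hq hcq
    omega
  have hPQ : t.c v < t.c u := by
    refine hK.no_split (fun x => t.c v < t.c x) ?_ hqK huK hcq
    intro x hx y hy hxc hyc
    obtain ⟨hxW, hxv, hxN⟩ := hKR x hx
    obtain ⟨hyW, hyv, hyN⟩ := hKR y hy
    have h1 := t.c.injective.ne hyv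
    have := no_b_edge h hv hxW (hRb y hyW hyv hyN) (by omega) hxc
    have hb := hRb y hyW hyv hyN
    have hxy : x ≠ y := by rintro rfl; exact hyc hxc
    have := t.b.injective.ne hxy
    omega
  have := hqa u huW hPQ
  omega

end

section
variable {t : Tri n} {W : Finset (Fin n)} {v : Fin n}

/-- What is known of the labels `R` left when the `a`-first label `v` and a `(c, a)`-corner `N` are
removed from `W`, if `W` has no proper corner. The property `D x` stands for "`x` is before all of
`N` in `b`". By `corner_ab` and `corner_bc`, certain corners of `R`, which would be corners of `W`, do
not occur. -/
structure Remainder (t : Tri n) (W : Finset (Fin n)) (v : Fin n) (R : Finset (Fin n))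
    (D : Fin n → Prop) : Prop where
  subW : ∀ x ∈ R, x ∈ W
  ne : ∀ x ∈ R, x ≠ v
  low_of_lt : ∀ x ∈ R, ∀ y ∈ R, t.b x < t.b y → D y → D x
  low_of_below : ∀ x ∈ R, t.b x < t.b v → t.c x < t.c v → D x
  lt_of_low : ∀ x ∈ R, D x → t.b x < t.b v
  exists_b_gt : ∃ e ∈ R, t.b v < t.b e
  exists_below : ∃ r ∈ R, t.b r < t.b v ∧ t.c r < t.c v
  exists_c_gt : ∃ q ∈ R, t.c v < t.c q
  corner_ab : ∀ K, Corner t.a t.b R K → ∃ x ∈ K, ¬ D x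
  corner_bc : ∀ K, Corner t.b t.c R K → ∃ x ∈ K, t.b x < t.b v

lemma Remainder.corner_ab_false (h : t.Good) (hv : FirstIn t W v) {R : Finset (Fin n)}
    {D : Fin n → Prop} (hR : Remainder t W v R D) {T : Finset (Fin n)}
    (hT : Corner t.a t.b R T) (hTR : T ≠ R) : False := by
  classical
  obtain ⟨K, hKT, hK⟩ := hT.exists_min
  obtain ⟨s0, hs0, hs0K⟩ : ∃ s ∈ R, s ∉ K := by
    by_contra hcon
    push Not at hcon
    exact hTR (Finset.Subset.antisymm hT.1 fun x hx => hKT (hcon x hx))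
  have hKR := hK.1.1
  have hc := hK.1.2.2
  obtain ⟨t0, ht0, ht0D⟩ := hR.corner_ab K hK.1
  have hDK : ∀ d ∈ R, D d → d ∈ K := by
    intro d hd hdD
    by_contra hdK
    exact ht0D (hR.low_of_lt t0 (hKR ht0) d hd (hc d hd hdK t0 ht0).2 hdD)
  obtain ⟨r, hr, hrb, hrc⟩ := hR.exists_below
  have hrK := hDK r hr (hR.low_of_below r hr hrb hrc)
  obtain ⟨q, hq, hqc⟩ := hR.exists_c_gt
  obtain ⟨e, he, heb⟩ := hR.exists_b_gt
  have hSE : ∀ s ∈ R, s ∉ K → t.c s < t.c v → t.b v < t.b s := by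
    intro s hs hsK hsc
    by_contra hb
    have := t.b.injective.ne (hR.ne s hs)
    exact hsK (hDK s hs (hR.low_of_below s hs (by omega) hsc))
  have hEc : ∀ s ∈ R, t.b v < t.b s → t.c s < t.c v := fun s hs =>
    not_both h hv (hR.subW s hs)
  have heS : ∃ s ∈ R, s ∉ K ∧ t.b v < t.b s := by
    by_cases heK : e ∈ K
    · exact ⟨s0, hs0, hs0K, heb.trans (hc s0 hs0 hs0K e heK).2⟩
    · exact ⟨e, he, heK, heb⟩
  -- Otherwise all of `K` would be before `v` in `c`, and all of `R` after `v` in `b` or before it in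
  -- `c`, against the existence of `q`.
  have hSE' : ∀ s ∈ R, s ∉ K → t.b v < t.b s → t.c s < t.c r := by
    intro s hs hsK hsb
    by_contra hcr
    have hsr : s ≠ r := by rintro rfl; exact hsK hrK
    have h1 := t.c.injective.ne hsr
    have h2 := hEc s hs hsb
    have hKc : ∀ x ∈ K, t.c x < t.c s := fun x hx =>
      h.unsplit' hK hs hsK hrK hx (by omega)
    have h3 : t.b v < t.b t0 := by
      by_contra hb
      have h4 := t.b.injective.ne (hR.ne t0 (hKR ht0))
      have h5 := hKc t0 ht0
      exact ht0D (hR.low_of_below t0 (hKR ht0) (by omega) (by omega))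
    by_cases hqK : q ∈ K
    · have := hKc q hqK
      omega
    · have := hc q hq hqK t0 ht0
      have := hEc q hq (by omega)
      omega
  obtain ⟨s1, hs1, hs1K, hs1b⟩ := heS
  -- The labels outside `K` after `v` in `b` now form a corner for `(b, c)`.
  obtain ⟨x, hx, hxb⟩ := hR.corner_bc ((R \ K).filter fun s => t.b v < t.b s) ⟨
    (Finset.filter_subset _ _).trans Finset.sdiff_subset, ⟨s1, by simp [hs1, hs1K, hs1b]⟩, by
    intro s hs hsS x hx
    simp only [Finset.mem_filter, Finset.mem_sdiff] at hsS hx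
    have h1 := hSE' x hx.1.1 hx.1.2 hx.2
    by_cases hsK : s ∈ K
    · exact ⟨(hc x hx.1.1 hx.1.2 s hsK).2, h.unsplit hK hx.1.1 hx.1.2 hrK hsK h1⟩
    · have h2 : ¬ t.b v < t.b s := fun hb => hsS ⟨⟨hs, hsK⟩, hb⟩
      have h3 : ¬ t.c s < t.c v := fun hcs => h2 (hSE s hs hsK hcs)
      omega⟩
  simp only [Finset.mem_filter] at hx
  omega

lemma Remainder.corner_bc_false (h : t.Good) (hv : FirstIn t W v) {R : Finset (Fin n)}
    {D : Fin n → Prop} (hR : Remainder t W v R D) {T : Finset (Fin n)}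
    (hT : Corner t.b t.c R T) (hTR : T ≠ R) : False := by
  classical
  obtain ⟨N, hNT, hN⟩ := hT.exists_min
  obtain ⟨s0, hs0, hs0N⟩ : ∃ s ∈ R, s ∉ N := by
    by_contra hcon
    push Not at hcon
    exact hTR (Finset.Subset.antisymm hT.1 fun x hx => hNT (hcon x hx))
  have hNR := hN.1.1
  have hc := hN.1.2.2
  obtain ⟨r1, hr1, hr1b, hr1c⟩ := hR.exists_below
  obtain ⟨q, hq, hqc⟩ := hR.exists_c_gt
  obtain ⟨x0, hx0, hx0b⟩ := hR.corner_bc N hN.1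
  obtain ⟨r, hr, hrN, hrb, hrc⟩ : ∃ r ∈ R, r ∈ N ∧ t.b r < t.b v ∧ t.c r < t.c v := by
    by_cases hr1N : r1 ∈ N
    · exact ⟨r1, hr1, hr1N, hr1b, hr1c⟩
    · exact ⟨x0, hNR hx0, hx0, hx0b, (hc r1 hr1 hr1N x0 hx0).2.trans hr1c⟩
  have hrD := hR.low_of_below r hr hrb hrc
  have hSD : ∀ s ∈ R, s ∉ N → D s := fun s hs hsN =>
    hR.low_of_lt s hs r hr (hc s hs hsN r hrN).1 hrD
  have hedge : ∀ r ∈ R, ∀ q ∈ R, t.b r < t.b v → t.c r < t.c v → t.c v < t.c q →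
      (t.a r < t.a q → t.b q < t.b r) ∧ (t.a q < t.a r → t.b r < t.b q) :=
    fun r _ q hq => no_b_edge h hv (hR.subW q hq)
  have hnar : ∀ s ∈ R, s ∉ N → t.a s < t.a r → t.c s < t.c v := by
    intro s hs hsN hsa
    by_contra hsc
    have h1 := t.c.injective.ne (hR.ne s hs)
    have h2 := hedge r hr s hs hrb hrc (by omega)
    have h3 := hc s hs hsN r hrN
    omega
  -- A corner of `R \ N` after `N` in `a` would be a corner of `R` consisting of low labels.
  have hX : ∀ K, Corner t.a t.b (R \ N) K → ∃ s ∈ K, t.a s < t.a r := by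
    intro K hK
    by_contra hcon
    push Not at hcon
    have hKR : ∀ x ∈ K, x ∈ R ∧ x ∉ N := fun x hx => Finset.mem_sdiff.1 (hK.1 hx)
    obtain ⟨x, hx, hxD⟩ := hR.corner_ab K ⟨fun x hx => (hKR x hx).1, hK.2.1, by
      intro s hs hsK x hx
      by_cases hsN : s ∈ N
      · have h1 : x ≠ r := by rintro rfl; exact (hKR _ hx).2 hrN
        have h2 := t.a.injective.ne h1
        have h3 := hcon x hx
        exact ⟨h.rot.unsplit' hN (hKR x hx).1 (hKR x hx).2 hrN hsN
          (by simp only [Tri.rot]; omega), (hc x (hKR x hx).1 (hKR x hx).2 s hsN).1⟩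
      · exact hK.2.2 s (Finset.mem_sdiff.2 ⟨hs, hsN⟩) hsK x hx⟩
    exact hxD (hSD x (hKR x hx).1 (hKR x hx).2)
  obtain ⟨s1, hs1, hs1a⟩ := hX _ (Corner.refl _ _ ⟨s0, by simp [hs0, hs0N]⟩)
  rw [Finset.mem_sdiff] at hs1
  have hs1c := hnar s1 hs1.1 hs1.2 hs1a
  have hqN : q ∉ N := fun hqN => by
    have := hc s1 hs1.1 hs1.2 q hqN
    omega
  obtain ⟨K, -, hK⟩ := (Corner.refl t.a t.b (W := R \ N) ⟨s0, by simp [hs0, hs0N]⟩).exists_min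
  have hKR : ∀ x ∈ K, x ∈ R ∧ x ∉ N := fun x hx => Finset.mem_sdiff.1 (hK.1.1 hx)
  obtain ⟨u, huK, hua⟩ := hX K hK.1
  have hqK : q ∈ K := by
    by_contra hqK
    have h1 := hK.1.2.2 q (Finset.mem_sdiff.2 ⟨hq, hqN⟩) hqK u huK
    have := hnar q hq hqN (by omega)
    omega
  have hu := hnar u (hKR u huK).1 (hKR u huK).2 hua
  -- The minimal corner `K` contains `q`, after `v` in `c`, and `u`, before `v` in `c`, but `hedge`
  -- leaves no edge between labels of these two kinds.
  have : t.c v < t.c u := by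
    refine hK.no_split (fun x => t.c v < t.c x) ?_ hqK huK hqc
    intro x hx y hy hxc hyc
    have h1 := t.c.injective.ne (hR.ne y (hKR y hy).1)
    have h2 := hR.lt_of_low y (hKR y hy).1 (hSD y (hKR y hy).1 (hKR y hy).2)
    have h3 := hedge y (hKR y hy).1 x (hKR x hx).1 h2 (by omega) hxc
    tauto
  omega

/-- If `W` minus its `a`-first label has a proper corner for `(c, a)`, take a maximal one. The remaining
labels have no proper corner for `(c, a)` by maximality, and none for the other two rotations by
`Remainder.corner_ab_false` and `Remainder.corner_bc_false`, against the induction hypothesis. -/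
lemma corner_ca_false (h : t.Good) (hu : Uncut t W) (hv : FirstIn t W v)
    (ih : ∀ R ⊂ W, 2 ≤ R.card → ¬ Uncut t R) {T : Finset (Fin n)}
    (hT : Corner t.c t.a (W.erase v) T) (hTW : T ≠ W.erase v) : False := by
  classical
  obtain ⟨N, hNW, hN, hmax⟩ := hT.exists_max hTW
  have hnv : ∀ x ∈ N, x ∈ W ∧ x ≠ v := fun x hx => by
    have := hN.1 hx; rw [Finset.mem_erase] at this; tauto
  have hcut : ∀ s ∈ W, s ≠ v → s ∉ N → ∀ x ∈ N, t.c s < t.c x ∧ t.a x < t.a s :=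
    fun s hs hsv hsN x hx => hN.2.2 s (Finset.mem_erase.2 ⟨hsv, hs⟩) hsN x hx
  have hvN : v ∉ N := fun hh => (hnv v hh).2 rfl
  obtain ⟨s0, hs0, hs0v, hs0N⟩ : ∃ s ∈ W, s ≠ v ∧ s ∉ N := by
    by_contra hcon
    push Not at hcon
    refine hNW (Finset.Subset.antisymm hN.1 fun x hx => ?_)
    rw [Finset.mem_erase] at hx
    exact hcon x hx.2 hx.1
  have hne : (W.erase v).Nonempty := ⟨s0, by simp [hs0, hs0v]⟩
  obtain ⟨q, hq, hqv, hqN, hqc⟩ : ∃ s ∈ W, s ≠ v ∧ s ∉ N ∧ t.c v < t.c s := by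
    by_contra hcon
    push Not at hcon
    have := hu.ca (insert v N) ⟨by
      intro x hx
      rw [Finset.mem_insert] at hx
      rcases hx with rfl | hx
      · exact hv.mem
      · exact (hnv x hx).1, by simp, by
      intro s hs hsN x hx
      rw [Finset.mem_insert] at hsN hx
      push Not at hsN
      rcases hx with rfl | hx
      · have h1 := hcon s hs hsN.1 hsN.2
        have h2 := t.c.injective.ne hsN.1
        exact ⟨by omega, hv.lt s hs hsN.1⟩
      · exact hcut s hs hsN.1 hsN.2 x hx⟩
    have h5 := hs0
    rw [← this, Finset.mem_insert] at h5
    exact h5.elim hs0v hs0N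
  have hNc : ∀ x ∈ N, t.c v < t.c x := fun x hx => hqc.trans (hcut q hq hqv hqN x hx).1
  have hNb : ∀ x ∈ N, t.b x < t.b v := fun x hx => by
    have h1 := not_both h hv (hnv x hx).1
    have h2 := hNc x hx
    have h3 := t.b.injective.ne (hnv x hx).2
    omega
  obtain ⟨n0, hn0⟩ := hN.2.1
  obtain ⟨e, he, heb⟩ := exists_b_lt hu hv hne
  have hev : e ≠ v := by rintro rfl; exact lt_irrefl _ heb
  have heN : e ∉ N := fun hh => by have := hNb e hh; omega
  obtain ⟨r, hr, hrb, hrc⟩ : ∃ r ∈ W, t.b r < t.b v ∧ t.c r < t.c v := by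
    by_contra hcon
    push Not at hcon
    have := hu.bc (W.filter fun x => t.b v < t.b x) ⟨Finset.filter_subset _ _,
      ⟨e, by simp [he, heb]⟩, by
      intro s hs hsE x hx
      simp only [Finset.mem_filter] at hsE hx
      have h1 := not_both h hv hx.1 hx.2
      have h2 : ¬ t.b v < t.b s := fun hh => hsE ⟨hs, hh⟩
      by_cases hsv : s = v
      · subst hsv; exact ⟨hx.2, h1⟩
      · have h3 := t.b.injective.ne hsv
        have h4 := hcon s hs
        omega⟩
    have h1 := hv.mem
    rw [← this] at h1
    simp at h1
  have hrv : r ≠ v := by rintro rfl; exact lt_irrefl _ hrb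
  have hrN : r ∉ N := fun hh => by have := hNc r hh; omega
  set R := (W.erase v) \ N with hRdef
  have hmem : ∀ x, x ∈ R ↔ x ∈ W ∧ x ≠ v ∧ x ∉ N := fun x => by
    rw [hRdef, Finset.mem_sdiff, Finset.mem_erase]; tauto
  have hcR : ∀ s ∈ R, ∀ x ∈ N, t.c s < t.c x ∧ t.a x < t.a s := fun s hs x hx =>
    hcut s ((hmem s).1 hs).1 ((hmem s).1 hs).2.1 ((hmem s).1 hs).2.2 x hx
  have hRW : ∀ s ∈ W, s ≠ v → s ∉ N → s ∈ R := fun s h1 h2 h3 => (hmem s).2 ⟨h1, h2, h3⟩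
  have hctx : Remainder t W v R (fun x => ∀ y ∈ N, t.b x < t.b y) :=
    { subW := fun x hx => ((hmem x).1 hx).1
      ne := fun x hx => ((hmem x).1 hx).2.1
      low_of_lt := fun x _ y _ hxy hy z hz => hxy.trans (hy z hz)
      low_of_below := fun x hx hxb hxc y hy =>
        (no_b_edge h hv (hnv y hy).1 hxb hxc (hNc y hy)).2 (hcR x hx y hy).2
      lt_of_low := fun x _ hxD => (hxD n0 hn0).trans (hNb n0 hn0)
      exists_b_gt := ⟨e, hRW e he hev heN, heb⟩
      exists_below := ⟨r, hRW r hr hrv hrN, hrb, hrc⟩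
      exists_c_gt := ⟨q, hRW q hq hqv hqN, hqc⟩
      corner_ab := by
        intro K hK
        by_contra hcon
        push Not at hcon
        have := hu.ab K ⟨fun x hx => ((hmem x).1 (hK.1 hx)).1, hK.2.1, by
          intro s hs hsK x hx
          have h1 := hcon x hx
          have hxR := hK.1 hx
          by_cases hsv : s = v
          · subst hsv
            exact ⟨hv.lt x ((hmem x).1 hxR).1 ((hmem x).1 hxR).2.1,
              (h1 n0 hn0).trans (hNb n0 hn0)⟩
          by_cases hsN : s ∈ N
          · exact ⟨(hcR x hxR s hsN).2, h1 s hsN⟩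
          · exact hK.2.2 s (hRW s hs hsv hsN) hsK x hx⟩
        have h1 := hv.mem
        rw [← this] at h1
        exact ((hmem v).1 (hK.1 h1)).2.1 rfl
      corner_bc := by
        intro K hK
        by_contra hcon
        push Not at hcon
        have hKb : ∀ x ∈ K, t.b v < t.b x := fun x hx => by
          have h1 := hcon x hx
          have h2 := t.b.injective.ne ((hmem x).1 (hK.1 hx)).2.1
          omega
        have := hu.bc K ⟨fun x hx => ((hmem x).1 (hK.1 hx)).1, hK.2.1, by
          intro s hs hsK x hx
          have h1 := hKb x hx
          have hxR := hK.1 hx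
          by_cases hsv : s = v
          · subst hsv
            exact ⟨h1, not_both h hv ((hmem x).1 hxR).1 h1⟩
          by_cases hsN : s ∈ N
          · exact ⟨(hNb s hsN).trans h1, (hcR x hxR s hsN).1⟩
          · exact hK.2.2 s (hRW s hs hsv hsN) hsK x hx⟩
        have h1 := hv.mem
        rw [← this] at h1
        exact ((hmem v).1 (hK.1 h1)).2.1 rfl }
  have hRsub : R ⊂ W := by
    refine ⟨fun x hx => ((hmem x).1 hx).1, fun hh => ?_⟩
    exact ((hmem v).1 (hh hv.mem)).2.1 rfl
  have hcard : 2 ≤ R.card := by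
    refine Finset.one_lt_card.2 ⟨e, hRW e he hev heN, r, hRW r hr hrv hrN, ?_⟩
    rintro rfl
    omega
  refine ih R hRsub hcard ⟨fun T hT => ?_, fun T hT => ?_, fun T hT => ?_⟩
  · by_contra hTR
    exact hctx.corner_ab_false h hv hT hTR
  · by_contra hTR
    exact hctx.corner_bc_false h hv hT hTR
  · by_contra hTR
    obtain ⟨y, hyR, hyT⟩ : ∃ y ∈ R, y ∉ T := by
      by_contra hcon
      push Not at hcon
      exact hTR (Finset.Subset.antisymm hT.1 hcon)
    have hy := (hmem y).1 hyR
    obtain ⟨z, hz⟩ := hT.2.1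
    have := hmax (N ∪ T) (by
      intro hh
      have : y ∈ N ∪ T := by rw [hh]; exact Finset.mem_erase.2 ⟨hy.2.1, hy.1⟩
      rw [Finset.mem_union] at this
      exact this.elim hy.2.2 hyT) ⟨by
        intro x hx
        rw [Finset.mem_union] at hx
        rcases hx with hx | hx
        · exact hN.1 hx
        · have := (hmem x).1 (hT.1 hx)
          exact Finset.mem_erase.2 ⟨this.2.1, this.1⟩, ⟨z, Finset.mem_union_right _ hz⟩, by
        intro s hs hsU x hx
        rw [Finset.mem_union] at hsU hx
        push Not at hsU
        rw [Finset.mem_erase] at hs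
        have hsR := hRW s hs.2 hs.1 hsU.1
        rcases hx with hx | hx
        · exact hcR s hsR x hx
        · exact hT.2.2 s hsR hsU.2 x hx⟩ Finset.subset_union_left
    have h1 : z ∈ N := by rw [← this]; exact Finset.mem_union_right _ hz
    exact ((hmem z).1 (hT.1 hz)).2.2 h1

end

/-- Every set of at least two labels has a proper corner for one of the three rotations. -/
theorem Tri.Good.not_uncut {t : Tri n} (h : t.Good) (W : Finset (Fin n)) (hW : 2 ≤ W.card) :
    ¬ Uncut t W := by
  classical
  induction W using Finset.strongInduction with
  | H W ih =>
    intro hu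
    obtain ⟨v, hvW, hvmin⟩ := Finset.exists_min_image W t.a (Finset.card_pos.1 (by omega))
    have hv : FirstIn t W v := ⟨hvW, fun x hx hxv => by
      have h1 := hvmin x hx
      have h2 := t.a.injective.ne hxv
      omega⟩
    have hcard := Finset.card_erase_of_mem hvW
    have hne : (W.erase v).Nonempty := Finset.card_pos.1 (by omega)
    obtain ⟨e, he, heb⟩ := exists_b_lt hu hv hne
    obtain ⟨q, hq, hqc⟩ := exists_c_lt hu hv hne
    have hec := not_both h hv he heb
    have hev : e ≠ v := by rintro rfl; exact lt_irrefl _ heb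
    have hqv : q ≠ v := by rintro rfl; exact lt_irrefl _ hqc
    have hcard2 : 2 ≤ (W.erase v).card := by
      refine Finset.one_lt_card.2 ⟨e, by simp [he, hev], q, by simp [hq, hqv], ?_⟩
      rintro rfl
      omega
    refine ih _ (Finset.erase_ssubset hvW) hcard2 ⟨fun T hT => ?_, fun T hT => ?_, fun T hT => ?_⟩
    · by_contra hTW
      exact corner_ab_false h hu hv hT hTW
    · by_contra hTW
      exact corner_bc_false h hu hv hT hTW
    · by_contra hTW
      exact corner_ca_false h hu hv ih hT hTW

/-! ### Twins and elementary moves -/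

namespace Tri

/-- Every third label is in the same class with respect to `i` and to `j`. -/
structure Twin (t : Tri n) (i j : Fin n) : Prop where
  ne : i ≠ j
  ab : ∀ k, k ≠ i → k ≠ j → (t.a i < t.a k ∧ t.b k < t.b i ↔ t.a j < t.a k ∧ t.b k < t.b j)
  bc : ∀ k, k ≠ i → k ≠ j → (t.b i < t.b k ∧ t.c k < t.c i ↔ t.b j < t.b k ∧ t.c k < t.c j)
  ca : ∀ k, k ≠ i → k ≠ j → (t.c i < t.c k ∧ t.a k < t.a i ↔ t.c j < t.c k ∧ t.a k < t.a j)

lemma Twin.rot {t : Tri n} {i j : Fin n} (h : t.Twin i j) : t.rot.Twin i j :=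
  ⟨h.ne, h.bc, h.ca, h.ab⟩

lemma Twin.symm {t : Tri n} {i j : Fin n} (h : t.Twin i j) : t.Twin j i :=
  ⟨h.ne.symm, fun k h1 h2 => (h.ab k h2 h1).symm, fun k h1 h2 => (h.bc k h2 h1).symm,
    fun k h1 h2 => (h.ca k h2 h1).symm⟩

/-- The exchange of `i` and `j` in the third order. -/
def swapC (t : Tri n) (i j : Fin n) : Tri n := ⟨t.a, t.b, t.c * swap i j⟩

lemma swapC_comm (t : Tri n) (i j : Fin n) : t.swapC i j = t.swapC j i := by
  simp [swapC, swap_comm]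

@[simp] lemma swapC_a (t : Tri n) (i j : Fin n) : (t.swapC i j).a = t.a := rfl
@[simp] lemma swapC_b (t : Tri n) (i j : Fin n) : (t.swapC i j).b = t.b := rfl
@[simp] lemma swapC_c_left (t : Tri n) (i j : Fin n) : (t.swapC i j).c i = t.c j := by
  simp [swapC]
@[simp] lemma swapC_c_right (t : Tri n) (i j : Fin n) : (t.swapC i j).c j = t.c i := by
  simp [swapC]
lemma swapC_c_of_ne (t : Tri n) {i j k : Fin n} (h1 : k ≠ i) (h2 : k ≠ j) :
    (t.swapC i j).c k = t.c k := by
  simp [swapC, swap_apply_of_ne_of_ne h1 h2]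

@[simp] lemma swapC_swapC (t : Tri n) (i j : Fin n) : (t.swapC i j).swapC i j = t := by
  simp [swapC, mul_assoc]

/-- A label `k ≠ i` lies in one of three classes with respect to `i`. -/
lemma Good.trichotomy {t : Tri n} (h : t.Good) {i k : Fin n} (hk : k ≠ i) :
    (t.a i < t.a k ∧ t.b k < t.b i) ∨ (t.b i < t.b k ∧ t.c k < t.c i) ∨
      (t.c i < t.c k ∧ t.a k < t.a i) := by
  have h1 := h.not_all i k
  have h2 := h.not_all k i
  have ha := t.a.injective.ne hk
  have hb := t.b.injective.ne hk
  have hc := t.c.injective.ne hk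
  omega

lemma Twin.trichotomy {t : Tri n} (h : t.Good) {i j k : Fin n} (ht : t.Twin i j) (hi : k ≠ i)
    (hj : k ≠ j) :
    (t.a i < t.a k ∧ t.a j < t.a k ∧ t.b k < t.b i ∧ t.b k < t.b j) ∨
    (t.b i < t.b k ∧ t.b j < t.b k ∧ t.c k < t.c i ∧ t.c k < t.c j) ∨
    (t.c i < t.c k ∧ t.c j < t.c k ∧ t.a k < t.a i ∧ t.a k < t.a j) := by
  have h1 := h.trichotomy hi
  have h2 := ht.ab k hi hj
  have h3 := ht.bc k hi hj
  have h4 := ht.ca k hi hj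
  rcases h1 with h1 | h1 | h1
  · exact Or.inl ⟨h1.1, (h2.1 h1).1, h1.2, (h2.1 h1).2⟩
  · exact Or.inr (Or.inl ⟨h1.1, (h3.1 h1).1, h1.2, (h3.1 h1).2⟩)
  · exact Or.inr (Or.inr ⟨h1.1, (h4.1 h1).1, h1.2, (h4.1 h1).2⟩)

lemma Twin.swapC {t : Tri n} (h : t.Good) {i j : Fin n} (ht : t.Twin i j) :
    (t.swapC i j).Twin i j := by
  refine ⟨ht.ne, fun k hi hj => ?_, fun k hi hj => ?_, fun k hi hj => ?_⟩ <;>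
    have h1 := ht.trichotomy h hi hj <;>
    simp only [swapC_a, swapC_b, swapC_c_left, swapC_c_right, swapC_c_of_ne t hi hj] <;>
    omega

/-- Swapping twins creates no pattern `(312, 231)` through `i`. If the pattern contains `j` too, then `i`
and `j` see its third label in different classes; otherwise replacing `i` by `j`, if necessary, gives
a pattern that was there before the swap. -/
lemma Twin.not_mem_cyc {t : Tri n} (h : t.Good) {i j : Fin n} (ht : t.Twin i j) {p q r : Fin n}
    (h1 : t.a p < t.a q) (h2 : t.a q < t.a r) (h3 : t.b q < t.b r) (h4 : t.b r < t.b p)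
    (h5 : (t.swapC i j).c r < (t.swapC i j).c p) (h6 : (t.swapC i j).c p < (t.swapC i j).c q) :
    p ≠ i ∧ q ≠ i ∧ r ≠ i := by
  have hpq : p ≠ q := by rintro rfl; omega
  have hqr : q ≠ r := by rintro rfl; omega
  have hpr : p ≠ r := by rintro rfl; omega
  have key := fun x (hxi : x ≠ i) (hxj : x ≠ j) => ht.trichotomy h hxi hxj
  have e1 := fun x (hxi : x ≠ i) (hxj : x ≠ j) => swapC_c_of_ne t hxi hxj
  refine ⟨?_, ?_, ?_⟩
  · rintro rfl
    by_cases hqj : q = j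
    · subst hqj
      have k1 := key r hpr.symm hqr.symm
      rw [e1 r hpr.symm hqr.symm] at h5
      simp only [swapC_c_left, swapC_c_right] at h5 h6
      omega
    by_cases hrj : r = j
    · subst hrj
      have k1 := key q hpq.symm hqr
      rw [e1 q hpq.symm hqr] at h6
      simp only [swapC_c_left, swapC_c_right] at h5 h6
      omega
    have k1 := key r hpr.symm hrj
    have k2 := key q hpq.symm hqj
    rw [e1 q hpq.symm hqj] at h6
    rw [e1 r hpr.symm hrj] at h5
    simp only [swapC_c_left] at h5 h6
    have := h.not_cyc p q r
    have := h.not_cyc j q r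
    omega
  · rintro rfl
    by_cases hpj : p = j
    · subst hpj
      have k1 := key r hqr.symm hpr.symm
      rw [e1 r hqr.symm hpr.symm] at h5
      simp only [swapC_c_left, swapC_c_right] at h5 h6
      omega
    by_cases hrj : r = j
    · subst hrj
      have k1 := key p hpq hpr
      rw [e1 p hpq hpr] at h5 h6
      simp only [swapC_c_left, swapC_c_right] at h5 h6
      omega
    have k1 := key r hqr.symm hrj
    have k2 := key p hpq hpj
    rw [e1 p hpq hpj] at h5 h6
    rw [e1 r hqr.symm hrj] at h5
    simp only [swapC_c_left] at h5 h6
    have := h.not_cyc p q r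
    have := h.not_cyc p j r
    omega
  · rintro rfl
    by_cases hpj : p = j
    · subst hpj
      have k1 := key q hqr hpq.symm
      rw [e1 q hqr hpq.symm] at h6
      simp only [swapC_c_left, swapC_c_right] at h5 h6
      omega
    by_cases hqj : q = j
    · subst hqj
      have k1 := key p hpr hpq
      rw [e1 p hpr hpq] at h5 h6
      simp only [swapC_c_left, swapC_c_right] at h5 h6
      omega
    have k1 := key q hqr hqj
    have k2 := key p hpr hpj
    rw [e1 p hpr hpj] at h5 h6
    rw [e1 q hqr hqj] at h6
    simp only [swapC_c_left] at h5 h6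
    have := h.not_cyc p q r
    have := h.not_cyc p q j
    omega

lemma Good.swapC {t : Tri n} (h : t.Good) {i j : Fin n} (ht : t.Twin i j)
    (ha : t.a i < t.a j) (hb : t.b j < t.b i) : (t.swapC i j).Good := by
  constructor
  · intro x y
    by_cases hxi : x = i
    · by_cases hyi : y = i
      · simp [hxi, hyi]
      by_cases hyj : y = j
      · subst hxi hyj
        simp only [swapC_a, swapC_b]
        omega
      · have h1 := ht.trichotomy h hyi hyj
        subst hxi
        simp only [swapC_a, swapC_b, swapC_c_left, swapC_c_of_ne t hyi hyj]
        omega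
    by_cases hxj : x = j
    · by_cases hyi : y = i
      · subst hxj hyi
        simp only [swapC_a, swapC_b]
        omega
      by_cases hyj : y = j
      · simp [hxj, hyj]
      · have h1 := ht.trichotomy h hyi hyj
        subst hxj
        simp only [swapC_a, swapC_b, swapC_c_right, swapC_c_of_ne t hyi hyj]
        omega
    have h1 := ht.trichotomy h hxi hxj
    by_cases hyi : y = i
    · subst hyi
      simp only [swapC_a, swapC_b, swapC_c_left, swapC_c_of_ne t hxi hxj]
      omega
    by_cases hyj : y = j
    · subst hyj
      simp only [swapC_a, swapC_b, swapC_c_right, swapC_c_of_ne t hxi hxj]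
      omega
    have := h.not_all x y
    simp only [swapC_a, swapC_b, swapC_c_of_ne t hyi hyj, swapC_c_of_ne t hxi hxj]
    omega
  · intro p q r h1 h2 h3 h4 h5 h6
    have k1 := ht.not_mem_cyc h h1 h2 h3 h4 h5 h6
    rw [swapC_comm] at h5 h6
    have k2 := ht.symm.not_mem_cyc h h1 h2 h3 h4 h5 h6
    rw [swapC_c_of_ne t k2.1 k1.1, swapC_c_of_ne t k2.2.2 k1.2.2] at h5
    rw [swapC_c_of_ne t k2.1 k1.1, swapC_c_of_ne t k2.2.1 k1.2.1] at h6
    exact h.not_cyc p q r h1 h2 h3 h4 h5 h6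

/-- A move in the third order. The orders `a` and `b` have to disagree on the twins; which of the twins
is called `i` is fixed by `a`. -/
def StepC (t t' : Tri n) : Prop :=
  ∃ i j, t.Twin i j ∧ t.a i < t.a j ∧ t.b j < t.b i ∧ t' = t.swapC i j

/-- A move in any of the three orders. -/
def Step (t t' : Tri n) : Prop :=
  t.StepC t' ∨ t.rot.StepC t'.rot ∨ t.rot.rot.StepC t'.rot.rot

lemma StepC.good {t t' : Tri n} (h : t.StepC t') (hg : t.Good) : t'.Good := by
  obtain ⟨i, j, ht, ha, hb, rfl⟩ := h
  exact hg.swapC ht ha hb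

lemma StepC.symm {t t' : Tri n} (h : t.StepC t') (hg : t.Good) : t'.StepC t := by
  obtain ⟨i, j, ht, ha, hb, rfl⟩ := h
  exact ⟨i, j, ht.swapC hg, ha, hb, by simp⟩

lemma Step.good {t t' : Tri n} (h : t.Step t') (hg : t.Good) : t'.Good := by
  rcases h with h | h | h
  · exact h.good hg
  · exact (h.good hg.rot).rot.rot
  · exact (h.good hg.rot.rot).rot

lemma Step.symm {t t' : Tri n} (h : t.Step t') (hg : t.Good) : t'.Step t := by
  rcases h with h | h | h
  · exact Or.inl (h.symm hg)
  · exact Or.inr (Or.inl (h.symm hg.rot))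
  · exact Or.inr (Or.inr (h.symm hg.rot.rot))

lemma Step.rot {t t' : Tri n} (h : t.Step t') : t.rot.Step t'.rot := by
  rcases h with h | h | h
  · exact Or.inr (Or.inr h)
  · exact Or.inl h
  · exact Or.inr (Or.inl h)

end Tri

/-! ### Straightening a module into a line -/

namespace Tri

/-- All members of `M` see a label outside `M` in the same class. -/
def IsModule (t : Tri n) (M : Finset (Fin n)) : Prop :=
  ∀ k ∉ M, (∀ i ∈ M, t.a i < t.a k ∧ t.b k < t.b i) ∨ (∀ i ∈ M, t.b i < t.b k ∧ t.c k < t.c i) ∨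
    (∀ i ∈ M, t.c i < t.c k ∧ t.a k < t.a i)

lemma IsModule.rot {t : Tri n} {M : Finset (Fin n)} (h : t.IsModule M) : t.rot.IsModule M :=
  fun k hk => by
    rcases h k hk with h | h | h
    · exact Or.inr (Or.inr h)
    · exact Or.inl h
    · exact Or.inr (Or.inl h)

lemma IsModule.mono {t : Tri n} {M N : Finset (Fin n)} (h : t.IsModule M) (hN : N ⊆ M)
    (h' : ∀ k ∈ M, k ∉ N → (∀ i ∈ N, t.a i < t.a k ∧ t.b k < t.b i) ∨
      (∀ i ∈ N, t.b i < t.b k ∧ t.c k < t.c i) ∨ (∀ i ∈ N, t.c i < t.c k ∧ t.a k < t.a i)) :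
    t.IsModule N := by
  intro k hk
  by_cases hkM : k ∈ M
  · exact h' k hkM hk
  · rcases h k hkM with h | h | h
    · exact Or.inl fun i hi => h i (hN hi)
    · exact Or.inr (Or.inl fun i hi => h i (hN hi))
    · exact Or.inr (Or.inr fun i hi => h i (hN hi))

/-- `t'` is reached from `t` by moves, and the ranks of the labels outside `M` are the same in both. -/
structure Reach (M : Finset (Fin n)) (t t' : Tri n) : Prop where
  steps : Relation.ReflTransGen Step t t'
  a : ∀ k ∉ M, t'.a k = t.a k
  b : ∀ k ∉ M, t'.b k = t.b k
  c : ∀ k ∉ M, t'.c k = t.c k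

lemma Reach.refl (M : Finset (Fin n)) (t : Tri n) : Reach M t t :=
  ⟨.refl, fun _ _ => rfl, fun _ _ => rfl, fun _ _ => rfl⟩

lemma Reach.trans {M : Finset (Fin n)} {t u w : Tri n} (h : Reach M t u) (h' : Reach M u w) :
    Reach M t w :=
  ⟨h.steps.trans h'.steps, fun k hk => (h'.a k hk).trans (h.a k hk),
    fun k hk => (h'.b k hk).trans (h.b k hk), fun k hk => (h'.c k hk).trans (h.c k hk)⟩

lemma Reach.mono {M N : Finset (Fin n)} {t u : Tri n} (h : Reach N t u) (hN : N ⊆ M) :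
    Reach M t u :=
  ⟨h.steps, fun k hk => h.a k fun hh => hk (hN hh), fun k hk => h.b k fun hh => hk (hN hh),
    fun k hk => h.c k fun hh => hk (hN hh)⟩

lemma Reach.rot {M : Finset (Fin n)} {t u : Tri n} (h : Reach M t u) : Reach M t.rot u.rot :=
  ⟨h.steps.lift Tri.rot fun _ _ hs => hs.rot, h.b, h.c, h.a⟩

lemma good_of_steps {t u : Tri n} (h : Relation.ReflTransGen Step t u) (hg : t.Good) :
    u.Good := by
  induction h with
  | refl => exact hg
  | tail _ hs ih => exact hs.good ih

/-- Permutations that agree outside `M` take the same values on `M`. -/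
lemma exists_eq_of_agree {f g : Perm (Fin n)} {M : Finset (Fin n)} (h : ∀ k ∉ M, g k = f k)
    {i : Fin n} (hi : i ∈ M) : ∃ j ∈ M, g i = f j := by
  refine ⟨f.symm (g i), ?_, by simp⟩
  by_contra hj
  have h1 := h _ hj
  rw [apply_symm_apply] at h1
  exact hj (by rwa [g.injective h1])

lemma Reach.isModule {M : Finset (Fin n)} {t u : Tri n} (h : Reach M t u) (hM : t.IsModule M) :
    u.IsModule M := by
  intro k hk
  rw [h.a k hk, h.b k hk, h.c k hk]
  have ha := fun i (hi : i ∈ M) => exists_eq_of_agree h.a hi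
  have hb := fun i (hi : i ∈ M) => exists_eq_of_agree h.b hi
  have hc := fun i (hi : i ∈ M) => exists_eq_of_agree h.c hi
  rcases hM k hk with h | h | h
  · refine Or.inl fun i hi => ?_
    obtain ⟨j, hj, e⟩ := ha i hi
    obtain ⟨l, hl, e'⟩ := hb i hi
    rw [e, e']
    exact ⟨(h j hj).1, (h l hl).2⟩
  · refine Or.inr (Or.inl fun i hi => ?_)
    obtain ⟨j, hj, e⟩ := hb i hi
    obtain ⟨l, hl, e'⟩ := hc i hi
    rw [e, e']
    exact ⟨(h j hj).1, (h l hl).2⟩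
  · refine Or.inr (Or.inr fun i hi => ?_)
    obtain ⟨j, hj, e⟩ := hc i hi
    obtain ⟨l, hl, e'⟩ := ha i hi
    rw [e, e']
    exact ⟨(h j hj).1, (h l hl).2⟩

lemma IsModule.twin {t : Tri n} {M : Finset (Fin n)} (h : t.IsModule M) {i j : Fin n}
    (hi : i ∈ M) (hj : j ∈ M) (hij : i ≠ j)
    (h' : ∀ k ∈ M, k ≠ i → k ≠ j →
      (t.a i < t.a k ∧ t.b k < t.b i ↔ t.a j < t.a k ∧ t.b k < t.b j) ∧
      (t.b i < t.b k ∧ t.c k < t.c i ↔ t.b j < t.b k ∧ t.c k < t.c j) ∧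
      (t.c i < t.c k ∧ t.a k < t.a i ↔ t.c j < t.c k ∧ t.a k < t.a j)) : t.Twin i j := by
  have key : ∀ k, k ≠ i → k ≠ j →
      (t.a i < t.a k ∧ t.b k < t.b i ↔ t.a j < t.a k ∧ t.b k < t.b j) ∧
      (t.b i < t.b k ∧ t.c k < t.c i ↔ t.b j < t.b k ∧ t.c k < t.c j) ∧
      (t.c i < t.c k ∧ t.a k < t.a i ↔ t.c j < t.c k ∧ t.a k < t.a j) := by
    intro k h1 h2
    by_cases hk : k ∈ M
    · exact h' k hk h1 h2
    · rcases h k hk with h | h | h <;>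
      · have e1 := h i hi
        have e2 := h j hj
        omega
  exact ⟨hij, fun k h1 h2 => (key k h1 h2).1, fun k h1 h2 => (key k h1 h2).2.1,
    fun k h1 h2 => (key k h1 h2).2.2⟩

/-- On `M` the orders `a` and `c` agree and `b` is opposite; for `M` the set of all labels this is the
3-permutation `start n`. -/
def IsLine (t : Tri n) (M : Finset (Fin n)) : Prop :=
  ∀ i ∈ M, ∀ j ∈ M, t.a i < t.a j → t.b j < t.b i ∧ t.c i < t.c j

/-- If `e` is `a`-last and `b`-first in the module `M`, and on the other labels `a` and `b` agree and `c`
is opposite, then `e` can be moved to the `c`-last place: it is always a twin of the next label after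
it in `c`. The number `m` bounds the number of labels of `M` after `e` in `c`. -/
lemma slide (M : Finset (Fin n)) (e : Fin n) (he : e ∈ M) (m : ℕ) : ∀ t : Tri n, t.Good →
    t.IsModule M → (∀ s ∈ M, s ≠ e → t.a s < t.a e ∧ t.b e < t.b s) →
    t.rot.IsLine (M.erase e) → (M.filter fun x => t.c e < t.c x).card ≤ m →
    ∃ t', Reach M t t' ∧ (∀ s ∈ M, s ≠ e → t'.a s < t'.a e ∧ t'.b e < t'.b s) ∧
      ∀ s ∈ M, s ≠ e → t'.c s < t'.c e := by
  classical
  induction m with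
  | zero =>
    intro t _ _ hX _ hm
    refine ⟨t, Reach.refl _ _, hX, fun s hs hse => ?_⟩
    rw [Nat.le_zero, Finset.card_eq_zero, Finset.filter_eq_empty_iff] at hm
    have h1 := hm hs
    have h2 := t.c.injective.ne hse
    omega
  | succ m ih =>
    intro t hg hM hX hline hm
    by_cases hemp : (M.filter fun x => t.c e < t.c x).Nonempty
    swap
    · refine ih t hg hM hX hline ?_
      rw [Finset.not_nonempty_iff_eq_empty.1 hemp]
      simp
    obtain ⟨i, hi, himin⟩ := Finset.exists_min_image _ t.c hemp
    simp only [Finset.mem_filter, and_imp] at hi himin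
    obtain ⟨hiM, hic⟩ := hi
    have hie : i ≠ e := by rintro rfl; exact lt_irrefl _ hic
    have hline' : ∀ x ∈ M, x ≠ e → ∀ y ∈ M, y ≠ e → t.b x < t.b y →
        t.c y < t.c x ∧ t.a x < t.a y := fun x hx hxe y hy hye hb =>
      hline x (Finset.mem_erase.2 ⟨hxe, hx⟩) y (Finset.mem_erase.2 ⟨hye, hy⟩) hb
    have htwin : t.Twin i e := by
      refine hM.twin hiM he hie fun k hk hki hke => ?_
      have h1 := himin k hk
      have h2 := hX k hk hke
      have h3 := hX i hiM hie
      have h4 := hline' k hk hke i hiM hie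
      have h5 := hline' i hiM hie k hk hke
      have h6 := t.b.injective.ne hki
      have h7 := t.c.injective.ne hke
      omega
    have hstep : t.Step (t.swapC i e) :=
      Or.inl ⟨i, e, htwin, (hX i hiM hie).1, (hX i hiM hie).2, rfl⟩
    have hr : Reach M t (t.swapC i e) := by
      refine ⟨.single hstep, fun _ _ => rfl, fun _ _ => rfl, fun k hk => ?_⟩
      refine swapC_c_of_ne t ?_ ?_ <;> rintro rfl
      · exact hk hiM
      · exact hk he
    obtain ⟨t', h1, h2⟩ := ih (t.swapC i e) (hstep.good hg) (hr.isModule hM) hX (by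
      intro x hx y hy hb
      rw [Finset.mem_erase] at hx hy
      have h1 := hline' x hx.2 hx.1 y hy.2 hy.1 hb
      refine ⟨?_, h1.2⟩
      change (t.swapC i e).c y < (t.swapC i e).c x
      by_cases hxi : x = i
      · subst hxi
        have hyx : y ≠ x := by rintro rfl; exact lt_irrefl _ hb
        rw [swapC_c_left, swapC_c_of_ne t hyx hy.1]
        have h2 := himin y hy.2
        have h3 := t.c.injective.ne hy.1
        omega
      · rw [swapC_c_of_ne t hxi hx.1]
        by_cases hyi : y = i
        · subst hyi
          rw [swapC_c_left]
          omega
        · rw [swapC_c_of_ne t hyi hy.1]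
          exact h1.1) (by
      refine Nat.le_of_lt_succ (lt_of_lt_of_le (Finset.card_lt_card ?_) hm)
      refine ⟨fun x hx => ?_, fun hh => ?_⟩
      · simp only [Finset.mem_filter, swapC_c_right] at hx ⊢
        refine ⟨hx.1, ?_⟩
        have hxe : x ≠ e := by rintro rfl; rw [swapC_c_right] at hx; omega
        by_cases hxi : x = i
        · subst hxi; exact hic
        · rw [swapC_c_of_ne t hxi hxe] at hx
          omega
      · have := hh (Finset.mem_filter.2 ⟨hiM, hic⟩)
        rw [Finset.mem_filter, swapC_c_right, swapC_c_left] at this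
        omega)
    exact ⟨t', hr.trans h1, h2⟩

/-- Whenever `M` is a module of an avoiding triple, moves inside `M` can turn it into a line. -/
def Linear (M : Finset (Fin n)) : Prop :=
  ∀ t : Tri n, t.Good → t.IsModule M → ∃ t', Reach M t t' ∧ t'.IsLine M

/-- As `Linear` concerns all triples, it provides lines of all three directions. -/
lemma Linear.rot {M : Finset (Fin n)} (h : Linear M) {t : Tri n} (hg : t.Good)
    (hM : t.IsModule M) : ∃ t', Reach M t t' ∧ t'.rot.IsLine M := by
  obtain ⟨u, hu, hl⟩ := h t.rot hg.rot hM.rot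
  exact ⟨u.rot.rot, hu.rot.rot, hl⟩

lemma exists_line_of_top {M : Finset (Fin n)} {e : Fin n} (he : e ∈ M)
    (ih : Linear (M.erase e)) {t : Tri n} (hg : t.Good) (hM : t.IsModule M)
    (hX : ∀ s ∈ M, s ≠ e → t.a s < t.a e ∧ t.b e < t.b s) :
    ∃ t', Reach M t t' ∧ t'.IsLine M := by
  have hmod : ∀ u : Tri n, u.IsModule M →
      (∀ s ∈ M, s ≠ e → u.a s < u.a e ∧ u.b e < u.b s) → u.IsModule (M.erase e) := by
    intro u hu huX
    refine hu.mono (Finset.erase_subset _ _) fun k hk hk' => Or.inl fun i hi => ?_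
    rw [Finset.mem_erase] at hi hk'
    have hke : k = e := by by_contra h; exact hk' ⟨h, hk⟩
    subst hke
    exact huX i hi.2 hi.1
  have hkeep : ∀ u w : Tri n, Reach (M.erase e) u w →
      (∀ s ∈ M, s ≠ e → u.a s < u.a e ∧ u.b e < u.b s) →
      ∀ s ∈ M, s ≠ e → w.a s < w.a e ∧ w.b e < w.b s := by
    intro u w hr hu s hs hse
    obtain ⟨x, hx, e1⟩ := exists_eq_of_agree hr.a (Finset.mem_erase.2 ⟨hse, hs⟩)
    obtain ⟨y, hy, e2⟩ := exists_eq_of_agree hr.b (Finset.mem_erase.2 ⟨hse, hs⟩)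
    rw [e1, e2, hr.a e (by simp), hr.b e (by simp)]
    rw [Finset.mem_erase] at hx hy
    exact ⟨(hu x hx.2 hx.1).1, (hu y hy.2 hy.1).2⟩
  obtain ⟨t1, hr1, hl1⟩ := ih.rot hg (hmod t hM hX)
  have hr1' := hr1.mono (Finset.erase_subset e M)
  obtain ⟨t2, hr2, hX2, hc2⟩ := slide M e he _ t1 (good_of_steps hr1.steps hg) (hr1'.isModule hM)
    (hkeep _ _ hr1 hX) hl1 le_rfl
  have hr12 := hr1'.trans hr2
  obtain ⟨t3, hr3, hl3⟩ := ih t2 (good_of_steps hr12.steps hg) (hmod t2 (hr12.isModule hM) hX2)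
  refine ⟨t3, hr12.trans (hr3.mono (Finset.erase_subset e M)), fun i hi j hj hij => ?_⟩
  have hX3 := hkeep _ _ hr3 hX2
  have hc3 : ∀ s ∈ M, s ≠ e → t3.c s < t3.c e := by
    intro s hs hse
    obtain ⟨x, hx, e1⟩ := exists_eq_of_agree hr3.c (Finset.mem_erase.2 ⟨hse, hs⟩)
    rw [e1, hr3.c e (by simp)]
    rw [Finset.mem_erase] at hx
    exact hc2 x hx.2 hx.1
  by_cases hie : i = e
  · subst hie
    have hji : j ≠ i := by rintro rfl; exact lt_irrefl _ hij
    have := hX3 j hj hji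
    omega
  by_cases hje : j = e
  · subst hje
    exact ⟨(hX3 i hi hie).2, hc3 i hi hie⟩
  · exact hl3 i (Finset.mem_erase.2 ⟨hie, hi⟩) j (Finset.mem_erase.2 ⟨hje, hj⟩) hij

lemma exists_line_of_corner {M T : Finset (Fin n)} (ih : ∀ N ⊂ M, Linear N) {t : Tri n}
    (hg : t.Good) (hM : t.IsModule M) (hT : Corner t.a t.b M T) (hTM : T ≠ M) :
    ∃ t', Reach M t t' ∧ t'.IsLine M := by
  classical
  obtain ⟨K, hKT, hK⟩ := hT.exists_min
  have hKM : K ⊂ M := by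
    refine (Finset.ssubset_iff_subset_ne).2 ⟨hK.1.1, ?_⟩
    rintro rfl
    exact hTM (Finset.Subset.antisymm hT.1 hKT)
  obtain ⟨x0, hx0⟩ := hK.1.2.1
  have hKmod : t.IsModule K := by
    refine hM.mono hKM.1 fun s hs hsK => Or.inr ?_
    have hc := hK.1.2.2 s hs hsK
    have hsx : s ≠ x0 := by rintro rfl; exact hsK hx0
    rcases lt_or_gt_of_ne (t.c.injective.ne hsx) with h | h
    · exact Or.inl fun i hi => ⟨(hc i hi).2, hg.unsplit hK hs hsK hx0 hi h⟩
    · exact Or.inr fun i hi => ⟨hg.unsplit' hK hs hsK hx0 hi h, (hc i hi).1⟩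
  obtain ⟨t1, hr1, hl1⟩ := ih K hKM t hg hKmod
  have hr1' := hr1.mono hKM.1
  obtain ⟨e, heK, hemax⟩ := Finset.exists_max_image K t1.a ⟨x0, hx0⟩
  have heM := hKM.1 heK
  obtain ⟨t2, hr2, hl2⟩ := exists_line_of_top heM (ih _ (Finset.erase_ssubset heM))
    (good_of_steps hr1.steps hg) (hr1'.isModule hM) (by
      intro s hs hse
      by_cases hsK : s ∈ K
      · have h1 := hemax s hsK
        have h2 := t1.a.injective.ne hse
        exact ⟨by omega, (hl1 s hsK e heK (by omega)).1⟩
      · obtain ⟨x, hx, e1⟩ := exists_eq_of_agree hr1.a heK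
        obtain ⟨y, hy, e2⟩ := exists_eq_of_agree hr1.b heK
        rw [e1, e2, hr1.a s hsK, hr1.b s hsK]
        exact ⟨(hK.1.2.2 s hs hsK x hx).1, (hK.1.2.2 s hs hsK y hy).2⟩)
  exact ⟨t2, hr1'.trans hr2, hl2⟩

/-- A line can be turned into a line of another direction: its `a`-first label is `b`-last and `c`-first,
so `exists_line_of_top` applies to the rotated triple. -/
lemma IsLine.exists_rot {M : Finset (Fin n)} (hcard : 2 ≤ M.card) (ih : ∀ N ⊂ M, Linear N)
    {t : Tri n} (hg : t.Good) (hM : t.IsModule M) (hl : t.IsLine M) :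
    ∃ t', Reach M t t' ∧ t'.rot.IsLine M := by
  obtain ⟨e, he, hemin⟩ := Finset.exists_min_image M t.a (Finset.card_pos.1 (by omega))
  obtain ⟨u, hu, hl'⟩ := exists_line_of_top he (ih _ (Finset.erase_ssubset he)) hg.rot hM.rot (by
    intro s hs hse
    have h1 := hemin s hs
    have h2 := t.a.injective.ne hse
    exact hl e he s hs (by omega))
  exact ⟨u.rot.rot, hu.rot.rot, hl'⟩

theorem linear (M : Finset (Fin n)) : Linear M := by
  induction M using Finset.strongInduction with
  | H M ih =>
    intro t hg hM
    by_cases hcard : 2 ≤ M.card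
    swap
    · refine ⟨t, Reach.refl _ _, fun i hi j hj hij => ?_⟩
      have := Finset.card_le_one.1 (by omega : M.card ≤ 1) i hi j hj
      subst this
      exact absurd hij (lt_irrefl _)
    by_contra hcon
    have hrot : ∀ u : Tri n, Reach M t u → ¬ u.IsLine M := fun u h1 h2 => hcon ⟨u, h1, h2⟩
    have hrot2 : ∀ u : Tri n, Reach M t u → ¬ u.rot.rot.IsLine M := by
      intro u h1 h2
      obtain ⟨w, hw, hl⟩ := h2.exists_rot hcard ih (good_of_steps h1.steps hg).rot.rot
        (h1.isModule hM).rot.rot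
      exact hrot w.rot (h1.trans hw.rot) hl
    have hrot1 : ∀ u : Tri n, Reach M t u → ¬ u.rot.IsLine M := by
      intro u h1 h2
      obtain ⟨w, hw, hl⟩ := h2.exists_rot hcard ih (good_of_steps h1.steps hg).rot
        (h1.isModule hM).rot
      exact hrot2 w.rot.rot (h1.trans hw.rot.rot) hl
    refine hg.not_uncut M hcard ⟨fun T hT => ?_, fun T hT => ?_, fun T hT => ?_⟩
    · by_contra hTM
      obtain ⟨u, hu, hl⟩ := exists_line_of_corner ih hg hM hT hTM
      exact hrot u hu hl
    · by_contra hTM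
      obtain ⟨u, hu, hl⟩ := exists_line_of_corner ih hg.rot hM.rot hT hTM
      exact hrot1 u.rot.rot hu.rot.rot hl
    · by_contra hTM
      obtain ⟨u, hu, hl⟩ := exists_line_of_corner ih hg.rot.rot hM.rot.rot hT hTM
      exact hrot2 u.rot hu.rot hl

end Tri

/-! ### Grid positions of the labels -/

namespace Tri

/-- The number of labels after `i` in `f` and before `i` in `g`. -/
def cnt (f g : Perm (Fin n)) (i : Fin n) : ℕ :=
  (Finset.univ.filter fun k => f i < f k ∧ g k < g i).card

/-- The point of the grid belonging to the label `i`. -/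
def pt (t : Tri n) (i : Fin n) : ℤ × ℤ := (cnt t.a t.b i, cnt t.c t.a i)

/-- The 3-permutation of a triple of orders: the labels are replaced by their ranks in `a`. -/
def proj (t : Tri n) : Perm3 n := (t.b * t.a⁻¹, t.c * t.a⁻¹)

/-- The triple of orders of a 3-permutation, labelled by position. -/
def ofPerm3 (p : Perm3 n) : Tri n := ⟨1, p.1, p.2⟩

@[simp] lemma proj_ofPerm3 (p : Perm3 n) : (ofPerm3 p).proj = p := by
  simp [proj, ofPerm3]

lemma gam_proj (t : Tri n) : Gam t.proj = Finset.univ.image t.pt := by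
  have key : ∀ i, (((rightInv t.proj.1 (t.a i)).card : ℤ), ((leftInv t.proj.2 (t.a i)).card : ℤ))
      = t.pt i := by
    intro i
    have h1 : rightInv t.proj.1 (t.a i) =
        (Finset.univ.filter fun k => t.a i < t.a k ∧ t.b k < t.b i).map t.a.toEmbedding := by
      ext j
      simp [rightInv, proj, Perm.inv_def]
    have h2 : leftInv t.proj.2 (t.a i) =
        (Finset.univ.filter fun k => t.c i < t.c k ∧ t.a k < t.a i).map t.a.toEmbedding := by
      ext j
      simp [leftInv, proj, Perm.inv_def, and_comm]
    rw [h1, h2, Finset.card_map, Finset.card_map]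
    rfl
  ext x
  simp only [Gam, Finset.mem_image, Finset.mem_univ, true_and]
  constructor
  · rintro ⟨j, rfl⟩
    exact ⟨t.a.symm j, by rw [← key]; simp⟩
  · rintro ⟨i, rfl⟩
    exact ⟨t.a i, key i⟩

lemma cnt_lt {f g : Perm (Fin n)} {i j : Fin n} (hf : f i < f j) (hg : g j < g i) :
    cnt f g j < cnt f g i := by
  refine Finset.card_lt_card ⟨fun k hk => ?_, fun h => ?_⟩
  · simp only [Finset.mem_filter, Finset.mem_univ, true_and] at hk ⊢
    omega
  · have := @h j (by simp [hf, hg])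
    simp at this

lemma Good.pt_injective {t : Tri n} (h : t.Good) : Function.Injective t.pt := by
  intro i j hij
  by_contra hne
  simp only [pt, Prod.mk.injEq, Nat.cast_inj] at hij
  have ha := t.a.injective.ne hne
  rcases h.trichotomy (Ne.symm hne) with h1 | h1 | h1
  · have := cnt_lt h1.1 h1.2
    omega
  · rcases lt_or_gt_of_ne ha with h2 | h2
    · have := cnt_lt h1.2 h2
      omega
    · have := cnt_lt h2 h1.1
      omega
  · have := cnt_lt h1.1 h1.2
    omega

/-- The contributions of two given labels `i` and `j` to `cnt f g k`, singled out. -/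
lemma cnt_split (f g : Perm (Fin n)) {i j : Fin n} (hij : i ≠ j) (k : Fin n) :
    cnt f g k = (Finset.univ.filter fun l => (l ≠ i ∧ l ≠ j) ∧ f k < f l ∧ g l < g k).card +
      (if f k < f i ∧ g i < g k then 1 else 0) + (if f k < f j ∧ g j < g k then 1 else 0) := by
  rw [cnt, Finset.card_filter, Finset.card_filter,
    ← Finset.add_sum_erase _ _ (Finset.mem_univ i),
    ← Finset.add_sum_erase _ _ (Finset.mem_erase.2 ⟨hij.symm, Finset.mem_univ j⟩)]
  rw [← Finset.add_sum_erase Finset.univ (fun l => if (l ≠ i ∧ l ≠ j) ∧ _ then 1 else 0)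
      (Finset.mem_univ i),
    ← Finset.add_sum_erase (Finset.univ.erase i)
      (fun l => if (l ≠ i ∧ l ≠ j) ∧ _ then 1 else 0)
      (Finset.mem_erase.2 ⟨hij.symm, Finset.mem_univ j⟩)]
  have : ∀ l ∈ (Finset.univ.erase i).erase j, (if f k < f l ∧ g l < g k then 1 else 0) =
      (if (l ≠ i ∧ l ≠ j) ∧ f k < f l ∧ g l < g k then 1 else 0) := by
    intro l hl
    simp only [Finset.mem_erase] at hl
    simp [hl.1, hl.2.1]
  rw [Finset.sum_congr rfl this]
  simp
  omega

lemma cnt_eq_of {f g f' g' : Perm (Fin n)} {i j k k' : Fin n}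
    (h : ∀ l, l ≠ i → l ≠ j → (f k < f l ∧ g l < g k ↔ f' k' < f' l ∧ g' l < g' k')) :
    (Finset.univ.filter fun l => (l ≠ i ∧ l ≠ j) ∧ f k < f l ∧ g l < g k).card =
    (Finset.univ.filter fun l => (l ≠ i ∧ l ≠ j) ∧ f' k' < f' l ∧ g' l < g' k').card := by
  congr 1
  ext l
  simp only [Finset.mem_filter, Finset.mem_univ, true_and]
  constructor
  · rintro ⟨h1, h2⟩
    exact ⟨h1, (h l h1.1 h1.2).1 h2⟩
  · rintro ⟨h1, h2⟩
    exact ⟨h1, (h l h1.1 h1.2).2 h2⟩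

/-- If all labels other than `i` and `j` contribute alike to two counts, the counts differ by the
contributions of `i` and `j` only. -/
lemma cnt_compare {f g f' g' : Perm (Fin n)} {i j : Fin n} (hij : i ≠ j) (k k' : Fin n)
    (h : ∀ l, l ≠ i → l ≠ j → (f k < f l ∧ g l < g k ↔ f' k' < f' l ∧ g' l < g' k')) :
    cnt f g k + (if f' k' < f' i ∧ g' i < g' k' then 1 else 0) +
      (if f' k' < f' j ∧ g' j < g' k' then 1 else 0) =
    cnt f' g' k' + (if f k < f i ∧ g i < g k then 1 else 0) +
      (if f k < f j ∧ g j < g k then 1 else 0) := by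
  rw [cnt_split f g hij, cnt_split f' g' hij, cnt_eq_of h]
  omega

/-- Twins that are ordered alike by all three orders lie on the same point of the grid. -/
lemma Twin.pt_eq {t : Tri n} {i j : Fin n} (h : t.Twin i j) (ha : t.a i < t.a j)
    (hb : t.b i < t.b j) (hc : t.c i < t.c j) : t.pt i = t.pt j := by
  have h1 : cnt t.a t.b i = cnt t.a t.b j := by
    rw [cnt_split _ _ h.ne i, cnt_split _ _ h.ne j, cnt_eq_of h.ab,
      if_neg (by omega), if_neg (by omega), if_neg (by omega), if_neg (by omega)]
  have h2 : cnt t.c t.a i = cnt t.c t.a j := by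
    rw [cnt_split _ _ h.ne i, cnt_split _ _ h.ne j, cnt_eq_of h.ca,
      if_neg (by omega), if_neg (by omega), if_neg (by omega), if_neg (by omega)]
  rw [pt, pt, h1, h2]

/-- The effect of a move on the class sizes: only the label `j` moves, and a unit of its class size for
`(b, c)` is transferred to `(c, a)`. The equations relating `i` and `j` say that the old and the new
point of `j` and the point of `i` are the three cells of a small triangle. -/
structure CntChange (t t' : Tri n) (i j : Fin n) : Prop where
  ne : i ≠ j
  ab : ∀ k, cnt t'.a t'.b k = cnt t.a t.b k
  bc : ∀ k, k ≠ j → cnt t'.b t'.c k = cnt t.b t.c k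
  ca : ∀ k, k ≠ j → cnt t'.c t'.a k = cnt t.c t.a k
  abi : cnt t.a t.b i = cnt t.a t.b j + 1
  bcj : cnt t.b t.c j = cnt t.b t.c i + 1
  caj : cnt t.c t.a j = cnt t.c t.a i
  bcj' : cnt t'.b t'.c j = cnt t.b t.c i
  caj' : cnt t'.c t'.a j = cnt t.c t.a i + 1

lemma Twin.cntChange {t : Tri n} (h : t.Good) {i j : Fin n} (ht : t.Twin i j)
    (ha : t.a i < t.a j) (hb : t.b j < t.b i) (hc : t.c i < t.c j) :
    CntChange t (t.swapC i j) i j := by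
  have key := fun x (hxi : x ≠ i) (hxj : x ≠ j) => ht.trichotomy h hxi hxj
  have e1 := fun x (hxi : x ≠ i) (hxj : x ≠ j) => swapC_c_of_ne t hxi hxj
  have ei := swapC_c_left t i j
  have ej := swapC_c_right t i j
  have cmp := fun f g f' g' => cnt_compare (f := f) (g := g) (f' := f') (g' := g') ht.ne
  refine ⟨ht.ne, fun _ => rfl, fun k hk => ?_, fun k hk => ?_, ?_, ?_, ?_, ?_, ?_⟩
  · have e := cmp t.b t.c t.b (t.swapC i j).c k k fun l hl1 hl2 => by
      have := key l hl1 hl2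
      by_cases hki : k = i
      · subst hki; rw [e1 l hl1 hl2, ei]; omega
      · rw [e1 l hl1 hl2, e1 k hki hk]
    rw [swapC_b]
    by_cases hki : k = i
    · subst hki
      simp only [ei, ej] at e
      split_ifs at e <;> omega
    · have := key k hki hk
      simp only [ei, ej, e1 k hki hk] at e
      split_ifs at e <;> omega
  · have e := cmp t.c t.a (t.swapC i j).c t.a k k fun l hl1 hl2 => by
      have := key l hl1 hl2
      by_cases hki : k = i
      · subst hki; rw [e1 l hl1 hl2, ei]; omega
      · rw [e1 l hl1 hl2, e1 k hki hk]
    rw [swapC_a]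
    by_cases hki : k = i
    · subst hki
      simp only [ei, ej] at e
      split_ifs at e <;> omega
    · have := key k hki hk
      simp only [ei, ej, e1 k hki hk] at e
      split_ifs at e <;> omega
  · have e := cmp t.a t.b t.a t.b i j ht.ab
    split_ifs at e <;> omega
  · have e := cmp t.b t.c t.b t.c i j ht.bc
    split_ifs at e <;> omega
  · have e := cmp t.c t.a t.c t.a i j ht.ca
    split_ifs at e <;> omega
  · have e := cmp t.b t.c t.b (t.swapC i j).c i j fun l hl1 hl2 => by
      have := key l hl1 hl2
      rw [e1 l hl1 hl2, ej]; omega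
    rw [swapC_b]
    simp only [ei, ej] at e
    split_ifs at e <;> omega
  · have e := cmp t.c t.a (t.swapC i j).c t.a i j fun l hl1 hl2 => by
      have := key l hl1 hl2
      rw [e1 l hl1 hl2, ej]; omega
    rw [swapC_a]
    simp only [ei, ej] at e
    split_ifs at e <;> omega

end Tri

lemma GridMove.symm {P Q : Finset (ℤ × ℤ)} (h : GridMove P Q) : GridMove Q P := by
  obtain ⟨x, y, h1, h2, h3, h4⟩ := h
  exact ⟨x, y, by rwa [symmDiff_comm], by rwa [symmDiff_comm], h4, h3⟩

lemma GridMove.card_eq {P Q : Finset (ℤ × ℤ)} (h : GridMove P Q) : P.card = Q.card := by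
  obtain ⟨x, y, h1, -, h3, h4⟩ := h
  have : P \ cells x y = Q \ cells x y := by
    ext z
    have hz := @h1 z
    simp only [Finset.mem_sdiff, Finset.mem_symmDiff] at hz ⊢
    tauto
  have e1 := Finset.card_sdiff_add_card_inter P (cells x y)
  have e2 := Finset.card_sdiff_add_card_inter Q (cells x y)
  rw [this] at e1
  omega

/-- If one marble moves from one cell of a small triangle to another and some other marble is on the
third cell, this is a solitaire move; injectivity ensures that the target was free. -/
lemma gridMove_image {f f' : Fin n → ℤ × ℤ} (hf : f.Injective) (hf' : f'.Injective) {i j : Fin n}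
    (hij : i ≠ j) (hff' : ∀ k, k ≠ j → f' k = f k) (hj : f' j ≠ f j) {x y : ℤ}
    (hc : cells x y = {f i, f j, f' j}) :
    GridMove (Finset.univ.image f) (Finset.univ.image f') := by
  have h1 : f j ∉ Finset.univ.image f' := by
    simp only [Finset.mem_image, Finset.mem_univ, true_and, not_exists]
    intro k hk
    by_cases hkj : k = j
    · subst hkj; exact hj hk
    · rw [hff' k hkj] at hk; exact hkj (hf hk)
  have h2 : f' j ∉ Finset.univ.image f := by
    simp only [Finset.mem_image, Finset.mem_univ, true_and, not_exists]
    intro k hk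
    by_cases hkj : k = j
    · subst hkj; exact hj hk.symm
    · rw [← hff' k hkj] at hk; exact hkj (hf' hk)
  have h3 : f j ∈ Finset.univ.image f := Finset.mem_image_of_mem _ (Finset.mem_univ _)
  have h4 : f' j ∈ Finset.univ.image f' := Finset.mem_image_of_mem _ (Finset.mem_univ _)
  have h5 : f i ∈ Finset.univ.image f := Finset.mem_image_of_mem _ (Finset.mem_univ _)
  have h6 : f i ∈ Finset.univ.image f' := by
    rw [← hff' i hij]; exact Finset.mem_image_of_mem _ (Finset.mem_univ _)
  have h7 : ∀ z, z ≠ f j → z ≠ f' j →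
      (z ∈ Finset.univ.image f ↔ z ∈ Finset.univ.image f') := by
    intro z hz hz'
    simp only [Finset.mem_image, Finset.mem_univ, true_and]
    constructor <;> rintro ⟨k, rfl⟩
    · have hkj : k ≠ j := by rintro rfl; exact hz rfl
      exact ⟨k, hff' k hkj⟩
    · have hkj : k ≠ j := by rintro rfl; exact hz' rfl
      exact ⟨k, (hff' k hkj).symm⟩
  have e1 : symmDiff (Finset.univ.image f) (Finset.univ.image f') = {f j, f' j} := by
    ext z
    simp only [Finset.mem_symmDiff, Finset.mem_insert, Finset.mem_singleton]
    by_cases hz : z = f j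
    · subst hz; tauto
    by_cases hz' : z = f' j
    · subst hz'; tauto
    have := h7 z hz hz'
    tauto
  have e2 : Finset.univ.image f ∩ cells x y = {f i, f j} := by
    rw [hc]
    ext z
    simp only [Finset.mem_inter, Finset.mem_insert, Finset.mem_singleton]
    constructor
    · rintro ⟨hz, rfl | rfl | rfl⟩ <;> tauto
    · rintro (rfl | rfl) <;> tauto
  have e3 : Finset.univ.image f' ∩ cells x y = {f i, f' j} := by
    rw [hc]
    ext z
    simp only [Finset.mem_inter, Finset.mem_insert, Finset.mem_singleton]
    constructor
    · rintro ⟨hz, rfl | rfl | rfl⟩ <;> tauto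
    · rintro (rfl | rfl) <;> tauto
  refine ⟨x, y, ?_, ?_, ?_, ?_⟩
  · rw [e1, hc]; exact Finset.subset_insert _ _
  · rw [e1]; exact Finset.card_pair hj.symm
  · rw [e2]; exact Finset.card_pair (hf.ne hij)
  · rw [e3]; exact Finset.card_pair (by rw [← hff' i hij]; exact hf'.ne hij)

namespace Tri

lemma CntChange.gridMove {t t' : Tri n} {i j : Fin n} (hg : t.Good) (hg' : t'.Good)
    (h : CntChange t t' i j ∨ CntChange t.rot t'.rot i j ∨ CntChange t.rot.rot t'.rot.rot i j) :
    GridMove (Gam t.proj) (Gam t'.proj) := by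
  rw [gam_proj, gam_proj]
  rcases h with h | h | h <;> obtain ⟨h0, h1, h2, h3, h4, h5, h6, h7, h8⟩ := h <;>
    try simp only [rot] at h1 h2 h3 h4 h5 h6 h7 h8
  · refine gridMove_image (x := cnt t.a t.b j) (y := cnt t.c t.a i) hg.pt_injective
      hg'.pt_injective h0 (fun k hk => ?_) (fun e => ?_) ?_
    · simp only [pt]; rw [h1 k, h3 k hk]
    · simp only [pt, Prod.mk.injEq, Nat.cast_inj] at e; omega
    · simp only [pt, cells, h1, h4, h6, h8]
      push_cast
      ext z; simp only [Finset.mem_insert, Finset.mem_singleton]; tauto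
  · refine gridMove_image (x := cnt t.a t.b i) (y := cnt t.c t.a i) hg.pt_injective
      hg'.pt_injective h0 (fun k hk => ?_) (fun e => ?_) ?_
    · simp only [pt]; rw [h3 k hk, h2 k hk]
    · simp only [pt, Prod.mk.injEq, Nat.cast_inj] at e; omega
    · simp only [pt, cells, h5, h6, h7, h8]
      push_cast
      ext z; simp only [Finset.mem_insert, Finset.mem_singleton]; tauto
  · refine gridMove_image (x := cnt t.a t.b i) (y := cnt t.c t.a j) hg.pt_injective
      hg'.pt_injective h0 (fun k hk => ?_) (fun e => ?_) ?_
    · simp only [pt]; rw [h2 k hk, h1 k]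
    · simp only [pt, Prod.mk.injEq, Nat.cast_inj] at e; omega
    · simp only [pt, cells, h1, h4, h5, h7]
      push_cast
      ext z; simp only [Finset.mem_insert, Finset.mem_singleton]; tauto

lemma StepC.cntChange {t t' : Tri n} (hg : t.Good) (h : t.StepC t') :
    ∃ i j, CntChange t t' i j ∨ CntChange t' t i j := by
  have hs := h.symm hg
  have hg' := h.good hg
  obtain ⟨i, j, ht, ha, hb, rfl⟩ := h
  refine ⟨i, j, ?_⟩
  rcases lt_or_gt_of_ne (t.c.injective.ne ht.ne) with hc | hc
  · exact Or.inl (ht.cntChange hg ha hb hc)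
  · refine Or.inr ?_
    have := (ht.swapC hg).cntChange hg' ha hb (by simpa using hc)
    simpa using this

lemma Step.gridMove {t t' : Tri n} (hg : t.Good) (h : t.Step t') :
    GridMove (Gam t.proj) (Gam t'.proj) := by
  have hg' := h.good hg
  rcases h with h | h | h
  · obtain ⟨i, j, h | h⟩ := h.cntChange hg
    · exact CntChange.gridMove hg hg' (Or.inl h)
    · exact (CntChange.gridMove hg' hg (Or.inl h)).symm
  · obtain ⟨i, j, h | h⟩ := h.cntChange hg.rot
    · exact CntChange.gridMove hg hg' (Or.inr (Or.inl h))
    · exact (CntChange.gridMove hg' hg (Or.inr (Or.inl h))).symm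
  · obtain ⟨i, j, h | h⟩ := h.cntChange hg.rot.rot
    · exact CntChange.gridMove hg hg' (Or.inr (Or.inr h))
    · exact (CntChange.gridMove hg' hg (Or.inr (Or.inr h))).symm

end Tri

/-! ### Translation to 3-permutations -/

namespace Tri

/-- The renaming of the labels by `e`. -/
def relabel (t : Tri n) (e : Perm (Fin n)) : Tri n := ⟨t.a * e, t.b * e, t.c * e⟩

lemma Good.relabel {t : Tri n} (h : t.Good) (e : Perm (Fin n)) : (t.relabel e).Good :=
  ⟨fun i j => h.not_all (e i) (e j), fun p q r => h.not_cyc (e p) (e q) (e r)⟩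

@[simp] lemma proj_relabel (t : Tri n) (e : Perm (Fin n)) : (t.relabel e).proj = t.proj := by
  simp [proj, relabel, mul_assoc]

lemma ofPerm3_proj (t : Tri n) : ofPerm3 t.proj = t.relabel t.a⁻¹ := by
  simp [ofPerm3, proj, relabel]

lemma Twin.relabel {t : Tri n} {i j : Fin n} (h : t.Twin i j) (e : Perm (Fin n)) :
    (t.relabel e).Twin (e.symm i) (e.symm j) := by
  have key : ∀ k, k ≠ e.symm i → k ≠ e.symm j → e k ≠ i ∧ e k ≠ j := by
    intro k h1 h2
    refine ⟨?_, ?_⟩ <;> rintro rfl <;> simp at h1 h2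
  refine ⟨e.symm.injective.ne h.ne, fun k h1 h2 => ?_, fun k h1 h2 => ?_, fun k h1 h2 => ?_⟩
  · simpa [Tri.relabel] using h.ab (e k) (key k h1 h2).1 (key k h1 h2).2
  · simpa [Tri.relabel] using h.bc (e k) (key k h1 h2).1 (key k h1 h2).2
  · simpa [Tri.relabel] using h.ca (e k) (key k h1 h2).1 (key k h1 h2).2

lemma StepC.relabel {t t' : Tri n} (h : t.StepC t') (e : Perm (Fin n)) :
    (t.relabel e).StepC (t'.relabel e) := by
  obtain ⟨i, j, ht, ha, hb, rfl⟩ := h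
  refine ⟨e.symm i, e.symm j, ht.relabel e, ?_, ?_, ?_⟩
  · simpa [Tri.relabel] using ha
  · simpa [Tri.relabel] using hb
  · simp [Tri.relabel, swapC, mul_assoc, swap_mul_eq_mul_swap, Perm.inv_def]

lemma Step.relabel {t t' : Tri n} (h : t.Step t') (e : Perm (Fin n)) :
    (t.relabel e).Step (t'.relabel e) := by
  rcases h with h | h | h
  · exact Or.inl (h.relabel e)
  · exact Or.inr (Or.inl (h.relabel e))
  · exact Or.inr (Or.inr (h.relabel e))

lemma contains_perm12_iff {p : Perm3 n} :
    Contains p (perm12, perm12) ↔ ∃ i j, i < j ∧ p.1 i < p.1 j ∧ p.2 i < p.2 j := by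
  constructor
  · rintro ⟨f, hf, hc⟩
    have h01 : perm12 0 < perm12 1 := by decide
    exact ⟨f 0, f 1, hf (by decide), (hc 0 1).1.2 h01, (hc 0 1).2.2 h01⟩
  · rintro ⟨i, j, hij, h1, h2⟩
    refine ⟨![i, j], ?_, ?_⟩
    · rw [Fin.strictMono_iff_lt_succ]
      simpa [Fin.forall_fin_succ] using hij
    · simp [Fin.forall_fin_succ, perm12, h1, h2, h1.le, h2.le]

lemma contains_perm312_iff {p : Perm3 n} :
    Contains p (perm312, perm231) ↔ ∃ i j k, i < j ∧ j < k ∧ p.1 j < p.1 k ∧ p.1 k < p.1 i ∧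
      p.2 k < p.2 i ∧ p.2 i < p.2 j := by
  constructor
  · rintro ⟨f, hf, hc⟩
    exact ⟨f 0, f 1, f 2, hf (by decide), hf (by decide), (hc 1 2).1.2 (by decide),
      (hc 2 0).1.2 (by decide), (hc 2 0).2.2 (by decide), (hc 0 1).2.2 (by decide)⟩
  · rintro ⟨i, j, k, hij, hjk, h1, h2, h3, h4⟩
    refine ⟨![i, j, k], ?_, ?_⟩
    · rw [Fin.strictMono_iff_lt_succ]
      simpa [Fin.forall_fin_succ] using ⟨hij, hjk⟩
    · simp [Fin.forall_fin_succ, perm312, perm231, h1, h2, h3, h4, h1.le, h2.le, h3.le, h4.le,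
        h1.trans h2, h3.trans h4, (h1.trans h2).le, (h3.trans h4).le]

lemma good_ofPerm3_iff {p : Perm3 n} :
    (ofPerm3 p).Good ↔ p ∈ Av n {pat12, pat312} := by
  have hav : p ∈ Av n {pat12, pat312} ↔
      ¬ Contains p (perm12, perm12) ∧ ¬ Contains p (perm312, perm231) := by
    simp [Av, pat12, pat312]
  rw [hav, contains_perm12_iff, contains_perm312_iff]
  push Not
  constructor
  · rintro ⟨h1, h2⟩
    refine ⟨fun i j hij h => (h1 i j hij h).le, fun i j k e1 e2 e3 e4 e5 => ?_⟩
    exact not_lt.1 (h2 i j k e1 e2 e3 e4 e5)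
  · rintro ⟨h1, h2⟩
    refine ⟨fun i j hij h => ?_, fun i j k e1 e2 e3 e4 e5 => not_lt.2 (h2 i j k e1 e2 e3 e4 e5)⟩
    exact lt_of_le_of_ne (h1 i j hij h) (p.2.injective.ne (ne_of_gt hij))

lemma Good.proj_mem {t : Tri n} (h : t.Good) : t.proj ∈ Av n {pat12, pat312} := by
  rw [← good_ofPerm3_iff, ofPerm3_proj]
  exact h.relabel _

lemma Twin.canMove {p : Perm3 n} {i j : Fin n}
    (h : (ofPerm3 p).Twin i j) (hij : i < j) : CanMove p i j := by
  have h1 := h.ab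
  have h2 := h.ca
  simp only [ofPerm3, Perm.one_apply] at h1 h2
  refine ⟨hij, ?_, ?_⟩
  · by_cases hs : p.1 j < p.1 i
    · right
      ext k
      simp only [rightInv, Finset.mem_filter, Finset.mem_univ, true_and, Finset.mem_insert]
      by_cases hki : k = i
      · subst hki; omega
      by_cases hkj : k = j
      · subst hkj; simp [hij, hs]
      simp [h1 k hki hkj, hkj]
    · left
      ext k
      simp only [rightInv, Finset.mem_filter, Finset.mem_univ, true_and]
      by_cases hki : k = i
      · subst hki; omega
      by_cases hkj : k = j
      · subst hkj; omega
      exact h1 k hki hkj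
  · by_cases hs : p.2 j < p.2 i
    · right
      ext k
      simp only [leftInv, Finset.mem_filter, Finset.mem_univ, true_and, Finset.mem_insert]
      by_cases hki : k = i
      · subst hki; simp [hij, hs]
      by_cases hkj : k = j
      · subst hkj; omega
      have := h2 k hki hkj
      omega
    · left
      ext k
      simp only [leftInv, Finset.mem_filter, Finset.mem_univ, true_and]
      by_cases hki : k = i
      · subst hki; omega
      by_cases hkj : k = j
      · subst hkj; omega
      have := h2 k hki hkj
      omega

/-- The admissibility condition compares the classes for `(a, b)` and `(c, a)`; the class for `(b, c)` is
their complement. -/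
lemma _root_.ThreePerm.CanMove.twin {p : Perm3 n} (hg : (ofPerm3 p).Good) {i j : Fin n}
    (h : CanMove p i j) : (ofPerm3 p).Twin i j := by
  obtain ⟨hij, hr, hl⟩ := h
  have key : ∀ k, k ≠ i → k ≠ j → (i < k ∧ p.1 k < p.1 i ↔ j < k ∧ p.1 k < p.1 j) ∧
      (p.2 i < p.2 k ∧ k < i ↔ p.2 j < p.2 k ∧ k < j) := by
    intro k hki hkj
    constructor
    · rcases hr with e | e <;>
        simpa [rightInv, hkj] using congrArg (k ∈ ·) e
    · rcases hl with e | e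
      · have := congrArg (k ∈ ·) e
        simp only [leftInv, Finset.mem_filter, Finset.mem_univ, true_and, eq_iff_iff] at this
        omega
      · have := congrArg (k ∈ ·) e
        simp only [leftInv, Finset.mem_filter, Finset.mem_univ, true_and, eq_iff_iff,
          Finset.mem_insert, hki, false_or] at this
        omega
  refine ⟨hij.ne, fun k h1 h2 => (key k h1 h2).1, fun k h1 h2 => ?_,
    fun k h1 h2 => (key k h1 h2).2⟩
  have t1 := hg.trichotomy h1
  have t2 := hg.trichotomy h2
  have := key k h1 h2
  simp only [ofPerm3, Perm.one_apply] at t1 t2 ⊢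
  omega

/-- The exchanges of the first values, of the second values, and of both are the swaps in `b`, in `c`, and,
after relabelling, in `a`. -/
lemma isExchange_of {p : Perm3 n} {i j : Fin n} {t' : Tri n}
    (h : t' = (ofPerm3 p).swapC i j ∨ t'.rot = (ofPerm3 p).rot.swapC i j ∨
      t'.rot.rot = (ofPerm3 p).rot.rot.swapC i j) : IsExchange p t'.proj i j := by
  rcases h with h | h | h
  · right; left
    simp [h, proj, ofPerm3, swapC]
  · right; right
    obtain ⟨a, b, c⟩ := t'
    simp only [rot, ofPerm3, swapC, Tri.mk.injEq] at h
    obtain ⟨rfl, rfl, rfl⟩ := h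
    simp [proj]
  · left
    obtain ⟨a, b, c⟩ := t'
    simp only [rot, ofPerm3, swapC, Tri.mk.injEq] at h
    obtain ⟨rfl, rfl, rfl⟩ := h
    simp [proj]

lemma _root_.ThreePerm.IsExchange.exists_tri {p q : Perm3 n} {i j : Fin n}
    (h : IsExchange p q i j) :
    ∃ t' : Tri n, t'.proj = q ∧ (t' = (ofPerm3 p).swapC i j ∨ t'.rot = (ofPerm3 p).rot.swapC i j ∨
      t'.rot.rot = (ofPerm3 p).rot.rot.swapC i j) := by
  rcases h with rfl | rfl | rfl
  · exact ⟨((ofPerm3 p).rot.rot.swapC i j).rot, by simp [proj, ofPerm3, swapC, rot],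
      Or.inr (Or.inr rfl)⟩
  · exact ⟨(ofPerm3 p).swapC i j, by simp [proj, ofPerm3, swapC], Or.inl rfl⟩
  · exact ⟨((ofPerm3 p).rot.swapC i j).rot.rot, by simp [proj, ofPerm3, swapC, rot],
      Or.inr (Or.inl rfl)⟩

lemma StepC.exists_swapC {t t' : Tri n} (h : t.StepC t') (f : Perm (Fin n)) :
    ∃ i j, t.Twin i j ∧ f i < f j ∧ t' = t.swapC i j := by
  obtain ⟨i, j, ht, -, -, rfl⟩ := h
  rcases lt_or_gt_of_ne (f.injective.ne ht.ne) with h | h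
  · exact ⟨i, j, ht, h, rfl⟩
  · exact ⟨j, i, ht.symm, h, swapC_comm _ _ _⟩

lemma Step.solitaireMove_ofPerm3 {p : Perm3 n} (hg : (ofPerm3 p).Good) {t' : Tri n}
    (h : (ofPerm3 p).Step t') : SolitaireMove p t'.proj := by
  have hmove := h.gridMove hg
  rw [proj_ofPerm3] at hmove
  refine ⟨fun q hq => good_ofPerm3_iff.1 hg q (Or.inl hq), ?_, hmove⟩
  rcases h with h | h | h <;> obtain ⟨i, j, ht, hij, he⟩ := h.exists_swapC 1
  · exact ⟨i, j, ht.canMove hij, isExchange_of (Or.inl he)⟩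
  · exact ⟨i, j, ht.rot.rot.canMove hij, isExchange_of (Or.inr (Or.inl he))⟩
  · exact ⟨i, j, ht.rot.canMove hij, isExchange_of (Or.inr (Or.inr he))⟩

lemma Step.solitaireMove {t t' : Tri n} (hg : t.Good) (h : t.Step t') :
    SolitaireMove t.proj t'.proj := by
  have h' := h.relabel t.a⁻¹
  rw [← ofPerm3_proj] at h'
  have := h'.solitaireMove_ofPerm3 (by rw [ofPerm3_proj]; exact hg.relabel _)
  rwa [proj_relabel] at this

/-- Swapping twins in the third order either is a move, or makes all three orders agree on them. -/
lemma Twin.stepC_or {t : Tri n} (hg : t.Good) {i j : Fin n} (ht : t.Twin i j) :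
    t.StepC (t.swapC i j) ∨ ∃ i' j', (t.swapC i j).Twin i' j' ∧ t.a i' < t.a j' ∧
      t.b i' < t.b j' ∧ (t.swapC i j).c i' < (t.swapC i j).c j' := by
  wlog ha : t.a i < t.a j generalizing i j
  · have hne := t.a.injective.ne ht.ne
    rw [swapC_comm]
    exact this ht.symm (by omega)
  rcases lt_or_gt_of_ne (t.b.injective.ne ht.ne) with hb | hb
  · exact Or.inr ⟨i, j, ht.swapC hg, ha, hb, by simpa using hg.not_all i j ha hb⟩
  · exact Or.inl ⟨i, j, ht, ha, hb, rfl⟩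

/-- A solitaire move on the grid does not change the number of marbles, so it cannot bring two labels to
the same point. -/
lemma collision_false {t t' : Tri n} (hg : t.Good) (hmove : GridMove (Gam t.proj) (Gam t'.proj))
    {i j : Fin n} (ht : t'.Twin i j) (ha : t'.a i < t'.a j) (hb : t'.b i < t'.b j)
    (hc : t'.c i < t'.c j) : False := by
  have h1 := hmove.card_eq
  rw [gam_proj, gam_proj, Finset.card_image_of_injective _ hg.pt_injective, eq_comm,
    Finset.card_image_iff] at h1
  exact ht.ne (h1 (by simp) (by simp) (ht.pt_eq ha hb hc))

lemma _root_.ThreePerm.SolitaireMove.exists_step {p q : Perm3 n} (hg : (ofPerm3 p).Good)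
    (h : SolitaireMove p q) : ∃ t', (ofPerm3 p).Step t' ∧ t'.proj = q := by
  obtain ⟨-, ⟨i, j, hcan, hex⟩, hmove⟩ := h
  have ht := hcan.twin hg
  obtain ⟨t', rfl, ht'⟩ := hex.exists_tri
  refine ⟨t', ?_, rfl⟩
  have hmove' : GridMove (Gam (ofPerm3 p).proj) (Gam t'.proj) := by rwa [proj_ofPerm3]
  rcases ht' with e | e | e
  · rcases ht.stepC_or hg with h | ⟨x, y, h1, h2, h3, h4⟩
    · exact Or.inl (e ▸ h)
    · rw [← e] at h1 h4
      subst e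
      exact (collision_false hg hmove' h1 h2 h3 h4).elim
  · rcases ht.rot.stepC_or hg.rot with h | ⟨x, y, h1, h2, h3, h4⟩
    · exact Or.inr (Or.inl (e ▸ h))
    · have ea : t'.rot.a = (ofPerm3 p).rot.a := by rw [e, swapC_a]
      have eb : t'.rot.b = (ofPerm3 p).rot.b := by rw [e, swapC_b]
      rw [← e] at h1 h4
      rw [← ea] at h2
      rw [← eb] at h3
      exact (collision_false hg hmove' h1.rot.rot h4 h2 h3).elim
  · rcases ht.rot.rot.stepC_or hg.rot.rot with h | ⟨x, y, h1, h2, h3, h4⟩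
    · exact Or.inr (Or.inr (e ▸ h))
    · have ea : t'.rot.rot.a = (ofPerm3 p).rot.rot.a := by rw [e, swapC_a]
      have eb : t'.rot.rot.b = (ofPerm3 p).rot.rot.b := by rw [e, swapC_b]
      rw [← e] at h1 h4
      rw [← ea] at h2
      rw [← eb] at h3
      exact (collision_false hg hmove' h1.rot h3 h4 h2).elim

lemma steps_symm {t u : Tri n} (hg : t.Good) (h : Relation.ReflTransGen Step t u) :
    Relation.ReflTransGen Step u t := by
  induction h with
  | refl => exact .refl
  | tail h1 hs ih => exact .head (hs.symm (good_of_steps h1 hg)) ih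

lemma steps_proj {t u : Tri n} (hg : t.Good) (h : Relation.ReflTransGen Step t u) :
    Relation.ReflTransGen SolitaireMove t.proj u.proj := by
  induction h with
  | refl => exact .refl
  | tail h1 hs ih => exact .tail ih (hs.solitaireMove (good_of_steps h1 hg))

lemma eq_one_of_strictMono {e : Perm (Fin n)} (h : StrictMono e) : e = 1 := by
  ext i
  simp [h.eq_id]

lemma IsLine.proj_eq {t : Tri n} (h : t.IsLine Finset.univ) : t.proj = start n := by
  have h2 : t.c * t.a⁻¹ = 1 := by
    refine eq_one_of_strictMono fun x y hxy => ?_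
    exact (h (t.a⁻¹ x) (by simp) (t.a⁻¹ y) (by simp) (by simpa using hxy)).2
  have h1 : Fin.revPerm * (t.b * t.a⁻¹) = 1 := by
    refine eq_one_of_strictMono fun x y hxy => ?_
    have := (h (t.a⁻¹ x) (by simp) (t.a⁻¹ y) (by simp) (by simpa using hxy)).1
    simpa using this
  have h3 : t.b * t.a⁻¹ = Fin.revPerm := by
    ext x
    have := congrArg (fun e : Perm (Fin n) => (Fin.rev (e x)).val) h1
    simpa using this
  rw [proj, h2, h3]
  rfl

lemma good_start : (ofPerm3 (start n)).Good := by
  constructor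
  · intro i j h1 h2
    simp [ofPerm3, start] at h1 h2
    omega
  · intro p q r h1 h2 h3
    simp [ofPerm3, start] at h1 h2 h3
    omega

end Tri

end ThreePerm

open ThreePerm Tri in
theorem mainTheorem3 (n : ℕ) (hn : 1 ≤ n) :
    ThreePerm.orbit (ThreePerm.start n) =
      ThreePerm.Av n {ThreePerm.pat12, ThreePerm.pat312} := by
  ext p
  rw [← good_ofPerm3_iff]
  constructor
  · intro h
    induction h with
    | refl => exact good_start
    | tail _ hs ih =>
      obtain ⟨t', hstep, rfl⟩ := hs.exists_step ih
      exact good_ofPerm3_iff.2 (hstep.good ih).proj_mem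
  · intro h
    obtain ⟨u, hu, hl⟩ :=
      linear Finset.univ (ofPerm3 p) h fun k hk => absurd (Finset.mem_univ k) hk
    have := steps_proj (good_of_steps hu.steps h) (steps_symm h hu.steps)
    rwa [hl.proj_eq, proj_ofPerm3] at this
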